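/- Fix $n\ge 2$. Let $\sigma$ be the surface measure on the unit sphere $S^{n-1}\subset\mathbb R^n$ normalized by $\sigma(S^{n-1})=1$, and $L^2=L^2(S^{n-1},\sigma)$. For $f\in L^1(S^{n-1})$ let $$Mf(e)=\sup_{\vartheta\in(0,\pi]}\frac1{\sigma(S_\vartheta(e))}\int_{S_\vartheta(e)}|f|\,d\sigma,\qquad S_\vartheta(e)=\{e'\in S^{n-1}:\langle e,e'\rangle\ge\cos\vartheta\},$$ be the spherical Hardy--Littlewood maximal function. For an origin-symmetric convex body $K\subset\mathbb R^n$ (compact, convex, with non-empty interior) let $h(\theta)=\max\{\langle x,\theta\rangle: x\in K\}$ and $\rho(\theta)=\max\{t>0: t\theta\in K\}$, $\theta\in S^{n-1}$, be its support and radial functions, and for $m\ge0$ let $h_m$ be the orthogonal projection of $h$ in $L^2$ onto the space of spherical harmonics of degree $m$ (the restrictions to $S^{n-1}$ of homogeneous harmonic polynomials of degree $m$). Then for every such $K$ one has $\rho\le h$ on $S^{n-1}$, $h=\sum_{m=0}^\infty h_m$ in $L^2$, and $h_m=0$ for odd $m$. Moreover, there is a constant $C>0$, depending only on $n$, such that for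 every $\varepsilon>0$ and every integer $l\ge0$ there is $\delta_0>0$ (depending on $\varepsilon$, $l$ and $n$) with the following property: if $K\subset\mathbb R^n$ is an origin-symmetric convex body with $\|h-1\|_\infty\le\delta_0$, and $$\eta=\sum_{m=1}^{l}h_m,\qquad \nu=\sum_{m=l+1}^{\infty}h_m,$$ then $$h(e)-\rho(e)\le\varepsilon\|\eta\|_{L^2}+C\,M\nu(e)\qquad\text{for every } e\in S^{n-1}.$$ -/

import Mathlib

open MeasureTheory Metric Set
open scoped ENNReal

noncomputable section

namespace SphHarm

/-- Euclidean space of dimension `n`. -/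
abbrev E (n : ℕ) : Type := EuclideanSpace ℝ (Fin n)

/-- The unit sphere of Euclidean `n`-space. -/
abbrev Sph (n : ℕ) : Type := sphere (0 : E n) 1

/-- The surface measure on the unit sphere, normalized to total mass one. -/
def sigma (n : ℕ) : Measure (Sph n) :=
  ((volume : Measure (E n)).toSphere univ)⁻¹ • (volume : Measure (E n)).toSphere

instance sigma_finite (n : ℕ) : IsFiniteMeasure (sigma n) := by
  constructor
  simp only [sigma, Measure.smul_apply, smul_eq_mul]
  exact lt_of_le_of_lt (ENNReal.inv_mul_le_one _) ENNReal.one_lt_top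

/-- The real Hilbert space of square integrable functions on the sphere. -/
abbrev L2 (n : ℕ) : Type := Lp ℝ 2 (sigma n)

/-- The class of a continuous function on the sphere in the space of square integrable functions. -/
def toL2 (n : ℕ) : C(Sph n, ℝ) →L[ℝ] L2 n := ContinuousMap.toLp (E := ℝ) 2 (sigma n) ℝ

/-- The `i`-th coordinate function on the sphere. -/
def coord (n : ℕ) (i : Fin n) : C(Sph n, ℝ) where
  toFun e := (e : E n) i
  continuous_toFun := by fun_prop

/-- Restriction of a real polynomial in `n` variables to the sphere. -/
def polyRestrict (n : ℕ) : MvPolynomial (Fin n) ℝ →ₐ[ℝ] C(Sph n, ℝ) :=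
  MvPolynomial.aeval (coord n)

/-- The Laplace operator on polynomials. -/
def polyLaplacian (n : ℕ) : MvPolynomial (Fin n) ℝ →ₗ[ℝ] MvPolynomial (Fin n) ℝ :=
  ∑ i : Fin n, (MvPolynomial.pderiv i).toLinearMap ∘ₗ (MvPolynomial.pderiv i).toLinearMap

/-- Harmonic polynomials that are homogeneous of degree `m`. -/
def harmonicPoly (n m : ℕ) : Submodule ℝ (MvPolynomial (Fin n) ℝ) :=
  MvPolynomial.homogeneousSubmodule (Fin n) ℝ m ⊓ LinearMap.ker (polyLaplacian n)

/-- Spherical harmonics of degree `m`: restrictions to the sphere of homogeneous harmonic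
polynomials of degree `m`, as a subspace of the square integrable functions. -/
def harmonics (n m : ℕ) : Submodule ℝ (L2 n) :=
  (harmonicPoly n m).map ((toL2 n).toLinearMap ∘ₗ (polyRestrict n).toLinearMap)

instance homogeneous_finite (n m : ℕ) :
    Module.Finite ℝ (MvPolynomial.homogeneousSubmodule (Fin n) ℝ m) :=
  Module.Finite.iff_fg.mpr (MvPolynomial.homogeneousSubmodule_fg (Fin n) ℝ m)

instance harmonics_finite (n m : ℕ) : Module.Finite ℝ (harmonics n m) := by
  have : Module.Finite ℝ (harmonicPoly n m) :=
    Submodule.finiteDimensional_of_le (inf_le_left :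
      harmonicPoly n m ≤ MvPolynomial.homogeneousSubmodule (Fin n) ℝ m)
  unfold harmonics
  infer_instance

/-- The component of degree `m` in the spherical harmonic decomposition of `f`: its orthogonal
projection to the space of spherical harmonics of degree `m`. -/
def component (n m : ℕ) (f : L2 n) : L2 n := (harmonics n m).starProjection f

/-- The sum of the components of degrees `1, …, l`. -/
def lowPart (n l : ℕ) (f : L2 n) : L2 n := ∑ m ∈ Finset.Icc 1 l, component n m f

/-- The sum (in the space of square integrable functions) of the components of all degrees
greater than `l`. -/
def highPart (n l : ℕ) (f : L2 n) : L2 n := ∑' m : ℕ, component n (l + 1 + m) f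

/-- The closed spherical cap with centre `e` and spherical radius `t`. -/
def cap {n : ℕ} (t : ℝ) (e : Sph n) : Set (Sph n) :=
  {e' | Real.cos t ≤ inner ℝ (e : E n) (e' : E n)}

/-- The spherical Hardy-Littlewood maximal function: the supremum over `t ∈ (0, π]` of the
averages of `|f|` over the caps of radius `t` centred at `e`. -/
def maximal {n : ℕ} (f : Sph n → ℝ) (e : Sph n) : ℝ≥0∞ :=
  ⨆ t ∈ Ioc (0 : ℝ) Real.pi,
    (sigma n (cap t e))⁻¹ * ∫⁻ x in cap t e, ENNReal.ofReal |f x| ∂(sigma n)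

/-- The support function of a convex body, `θ ↦ max {⟨x, θ⟩ : x ∈ K}`, on the sphere. -/
def support {n : ℕ} (K : ConvexBody (E n)) : C(Sph n, ℝ) where
  toFun e := sSup ((fun x : E n => inner ℝ x (e : E n)) '' (K : Set (E n)))
  continuous_toFun := by
    refine K.isCompact.continuous_sSup (f := fun (e : Sph n) (x : E n) => inner ℝ x (e : E n)) ?_
    change Continuous fun p : Sph n × E n => inner ℝ p.2 (p.1 : E n)
    fun_prop

/-- The radial function of a convex body, `θ ↦ max {t > 0 : t θ ∈ K}`, on the sphere. -/
def radial {n : ℕ} (K : ConvexBody (E n)) (e : Sph n) : ℝ :=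
  sSup {t : ℝ | 0 < t ∧ t • (e : E n) ∈ K}

/-- Origin-symmetric convex bodies: compact convex sets with interior points that are symmetric
with respect to the origin. -/
structure IsSymmBody {n : ℕ} (K : ConvexBody (E n)) : Prop where
  interior_nonempty : (interior (K : Set (E n))).Nonempty
  neg_mem : ∀ x ∈ K, -x ∈ K

end SphHarm

end

/-! Extend `h` to a positively homogeneous convex function `H` on the whole space. If `s` exceeds
`ρ(e)`, separation of `s e` from `K` gives a direction `u` with `h(u) < s⟨e,u⟩ = s - s d²/2`, where
`d = |u - e|`. Hence `h(e) - s` is less than `h(e) - h(u) - s d²/2`. Closeness of `h` to 1 forces `d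
≤ 2√δ`.

Convexity gives, for every `v`, `H(e) ≤ (H(e+rv) + H(e-rv))/2` and `H(u) ≥ 2H(u+rv) - H(u+2rv)`.
Take `r = d/10`, split `h = c + q + k` into its degree-zero, low-degree and high-degree parts, and
average over the unit ball of `v`. The constant part contributes at most `c d²/40`, because the
terms of order zero and one cancel; this is absorbed by `s d²/2`. The low part lies in a
finite-dimensional space, where the `L²` norm controls Lipschitz constants, so it contributes `O(d
‖η‖)`, which is small compared with `‖η‖`. The averages of the high part are taken over balls of
radius comparable to `d` near `e`, and polar coordinates bound them by `Mν(e)`. Letting `s` decrease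
to `ρ(e)` finishes the estimate (`support_sub_le_add_maximal`, `support_sub_radial_le`).

The harmonic expansion rests on Gaussian integrals. Integration by parts and Euler's identity make
harmonic polynomials orthogonal to homogeneous polynomials of lower degree. This gives orthogonality
on the sphere and, through `p = h + |x|² q`, completeness. -/

noncomputable section

namespace SphHarm

variable {n : ℕ}

/-! ### Polynomials and their Gaussian integrals -/

/-- The value of a polynomial at a point of Euclidean space. -/
def polyEval (x : E n) : MvPolynomial (Fin n) ℝ →ₐ[ℝ] ℝ := MvPolynomial.aeval fun i => x i

@[simp] theorem polyEval_X (x : E n) (i : Fin n) : polyEval x (MvPolynomial.X i) = x i := by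
  simp [polyEval]

@[simp] theorem polyEval_C (x : E n) (a : ℝ) : polyEval x (MvPolynomial.C a) = a := by
  simp [polyEval]

theorem polyRestrict_apply (p : MvPolynomial (Fin n) ℝ) (e : Sph n) :
    polyRestrict n p e = polyEval (e : E n) p := by
  induction p using MvPolynomial.induction_on with
  | C a => simp [polyRestrict]
  | add p q hp hq => simp [hp, hq]
  | mul_X p i hp => simp [hp]; simp [polyRestrict, coord]

theorem continuous_polyEval (p : MvPolynomial (Fin n) ℝ) :
    Continuous fun x : E n => polyEval x p := by
  induction p using MvPolynomial.induction_on with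
  | C a => simpa using continuous_const
  | add p q hp hq => simp only [map_add]; exact hp.add hq
  | mul_X p i hp =>
    simp only [map_mul, polyEval_X]
    fun_prop

theorem polyEval_smul {p : MvPolynomial (Fin n) ℝ} {d : ℕ} (hp : p.IsHomogeneous d) (t : ℝ)
    (x : E n) : polyEval (t • x) p = t ^ d * polyEval x p := by
  simp only [polyEval, MvPolynomial.aeval_def, MvPolynomial.eval₂_eq, Finset.mul_sum]
  refine Finset.sum_congr rfl fun s hs => ?_
  rw [hp.degree_eq_sum_deg_support hs]
  simp only [PiLp.smul_apply, smul_eq_mul, mul_pow, Finset.prod_mul_distrib,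
    Finset.prod_pow_eq_pow_sum]
  ring

theorem hasFDerivAt_polyEval (p : MvPolynomial (Fin n) ℝ) (x : E n) :
    HasFDerivAt (fun x : E n => polyEval x p)
      (∑ i, polyEval x (MvPolynomial.pderiv i p) • (EuclideanSpace.proj i : E n →L[ℝ] ℝ)) x := by
  induction p using MvPolynomial.induction_on with
  | C a => simpa using hasFDerivAt_const a x
  | add p q hp hq =>
    simp only [map_add, add_smul, Finset.sum_add_distrib]
    exact hp.add hq
  | mul_X p j hp =>
    have h := hp.mul (EuclideanSpace.proj j : E n →L[ℝ] ℝ).hasFDerivAt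
    simp only [map_mul, polyEval_X]
    refine h.congr_fderiv ?_
    ext v
    simp [Derivation.leibniz, MvPolynomial.pderiv_X, Pi.single_apply, add_mul,
      Finset.sum_add_distrib, Finset.mul_sum, mul_assoc, apply_ite]

theorem abs_polyEval_monomial_le (s : Fin n →₀ ℕ) (a : ℝ) (x : E n) :
    |polyEval x (MvPolynomial.monomial s a)| ≤ |a| * ‖x‖ ^ (s.sum fun _ k => k) := by
  rw [polyEval, MvPolynomial.aeval_monomial, abs_mul, Finsupp.prod, Finset.abs_prod,
    Finsupp.sum, ← Finset.prod_pow_eq_pow_sum]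
  simp only [Algebra.algebraMap_self, RingHom.id_apply, abs_pow]
  gcongr with i hi
  exact PiLp.norm_apply_le x i

theorem integrable_norm_pow_mul_exp (hn : 0 < n) (d : ℕ) :
    Integrable fun x : E n => ‖x‖ ^ d * Real.exp (-‖x‖ ^ 2) := by
  have : Nonempty (Fin n) := ⟨⟨0, hn⟩⟩
  have : Nontrivial (E n) := inferInstance
  refine (integrable_fun_norm_addHaar (volume : Measure (E n))
    (f := fun r => r ^ d * Real.exp (-r ^ 2))).2 ?_
  have h := integrableOn_rpow_mul_exp_neg_mul_sq one_pos (s := ((n - 1 + d : ℕ) : ℝ))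
    (by have : (0:ℝ) ≤ ((n - 1 + d : ℕ) : ℝ) := by positivity
        linarith)
  refine h.congr_fun (fun r hr => ?_) measurableSet_Ioi
  simp only [Real.rpow_natCast, finrank_euclideanSpace, Fintype.card_fin, smul_eq_mul]
  rw [pow_add]
  ring_nf

theorem integrable_polyEval_mul_exp (hn : 0 < n) (p : MvPolynomial (Fin n) ℝ) :
    Integrable fun x : E n => polyEval x p * Real.exp (-‖x‖ ^ 2) := by
  induction p using MvPolynomial.induction_on' with
  | monomial s a =>
    refine ((integrable_norm_pow_mul_exp hn (s.sum fun _ k => k)).const_mul |a|).mono' ?_ ?_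
    · exact ((continuous_polyEval _).mul (by fun_prop)).aestronglyMeasurable
    · refine Filter.Eventually.of_forall fun x => ?_
      rw [Real.norm_eq_abs, abs_mul, abs_of_pos (Real.exp_pos _), ← mul_assoc]
      gcongr
      exact abs_polyEval_monomial_le s a x
  | add p q hp hq => simp only [map_add, add_mul]; exact hp.add hq

/-- The integral of a polynomial against the Gaussian weight `exp (-|x|²)`. -/
def gaussInt (p : MvPolynomial (Fin n) ℝ) : ℝ := ∫ x : E n, polyEval x p * Real.exp (-‖x‖ ^ 2)

theorem gaussInt_add (hn : 0 < n) (p q : MvPolynomial (Fin n) ℝ) :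
    gaussInt (p + q) = gaussInt p + gaussInt q := by
  simp only [gaussInt, map_add, add_mul]
  exact integral_add (integrable_polyEval_mul_exp hn p) (integrable_polyEval_mul_exp hn q)

theorem gaussInt_smul (a : ℝ) (p : MvPolynomial (Fin n) ℝ) :
    gaussInt (a • p) = a * gaussInt p := by
  simp only [gaussInt, map_smul, smul_eq_mul, mul_assoc]
  exact integral_const_mul _ _

theorem gaussInt_sum (hn : 0 < n) {ι : Type*} (s : Finset ι) (p : ι → MvPolynomial (Fin n) ℝ) :
    gaussInt (∑ i ∈ s, p i) = ∑ i ∈ s, gaussInt (p i) := by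
  simp only [gaussInt, map_sum, Finset.sum_mul]
  exact integral_finsetSum _ fun i _ => integrable_polyEval_mul_exp hn (p i)

/-- Integration by parts: the `i`-th derivative of `exp (-|x|²)` is `-2 x_i exp (-|x|²)`. -/
theorem gaussInt_X_mul (hn : 0 < n) (i : Fin n) (p : MvPolynomial (Fin n) ℝ) :
    2 * gaussInt (MvPolynomial.X i * p) = gaussInt (MvPolynomial.pderiv i p) := by
  have hg (x : E n) : HasFDerivAt (fun x : E n => Real.exp (-‖x‖ ^ 2))
      (Real.exp (-‖x‖ ^ 2) • -((2 : ℝ) • (innerSL ℝ x : E n →L[ℝ] ℝ))) x :=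
    ((hasStrictFDerivAt_norm_sq x).hasFDerivAt.neg.exp).congr_fderiv (by
      ext v; simp [two_smul])
  have hp' (x : E n) : (∑ j, polyEval x (MvPolynomial.pderiv j p) •
      (EuclideanSpace.proj j : E n →L[ℝ] ℝ)) (EuclideanSpace.single i 1) =
      polyEval x (MvPolynomial.pderiv i p) := by
    simp
  have hg' (x : E n) : (Real.exp (-‖x‖ ^ 2) • -((2 : ℝ) • (innerSL ℝ x : E n →L[ℝ] ℝ)))
      (EuclideanSpace.single i (1:ℝ)) =
      -2 * (x i * Real.exp (-‖x‖ ^ 2)) := by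
    simp [EuclideanSpace.inner_single_right]; ring
  have key := integral_bilinear_hasFDerivAt_right_eq_neg_left_of_integrable
    (μ := (volume : Measure (E n)))
    (f := fun x : E n => polyEval x p) (g := fun x : E n => Real.exp (-‖x‖ ^ 2))
    (v := EuclideanSpace.single i (1 : ℝ)) (B := ContinuousLinearMap.mul ℝ ℝ)
    (f' := fun x => ∑ j, polyEval x (MvPolynomial.pderiv j p) •
      (EuclideanSpace.proj j : E n →L[ℝ] ℝ))
    (g' := fun x => Real.exp (-‖x‖ ^ 2) • -((2 : ℝ) • (innerSL ℝ x : E n →L[ℝ] ℝ)))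
    (by simp only [hp']; exact integrable_polyEval_mul_exp hn (MvPolynomial.pderiv i p))
    (by
      simp only [hg']
      refine ((integrable_polyEval_mul_exp hn (MvPolynomial.X i * p)).const_mul (-2)).congr
        (Filter.Eventually.of_forall fun x => ?_)
      simp; ring)
    (integrable_polyEval_mul_exp hn p) (fun x _ => hasFDerivAt_polyEval p x) (fun x _ => hg x)
  simp only [hg', hp', ContinuousLinearMap.mul_apply'] at key
  have h2 : ∫ x : E n, polyEval x p * (-2 * (x i * Real.exp (-‖x‖ ^ 2))) =
      -(2 * gaussInt (MvPolynomial.X i * p)) := by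
    rw [gaussInt, ← integral_const_mul, ← integral_neg]
    congr 1; ext x; simp; ring
  rw [h2] at key
  exact neg_injective key

/-! ### Gaussian orthogonality of harmonic polynomials -/

theorem polyLaplacian_apply (p : MvPolynomial (Fin n) ℝ) :
    polyLaplacian n p = ∑ i, MvPolynomial.pderiv i (MvPolynomial.pderiv i p) := by
  simp [polyLaplacian]

theorem pderiv_comm (i j : Fin n) (p : MvPolynomial (Fin n) ℝ) :
    MvPolynomial.pderiv i (MvPolynomial.pderiv j p) =
      MvPolynomial.pderiv j (MvPolynomial.pderiv i p) := by
  induction p using MvPolynomial.induction_on with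
  | C a => simp
  | add p q hp hq => simp [hp, hq]
  | mul_X p k hp =>
    simp only [MvPolynomial.pderiv_mul, map_add, hp, MvPolynomial.pderiv_X, Pi.single_apply]
    split_ifs <;> simp
    ring

theorem mem_harmonicPoly {m : ℕ} {p : MvPolynomial (Fin n) ℝ} :
    p ∈ harmonicPoly n m ↔ p.IsHomogeneous m ∧ polyLaplacian n p = 0 := by
  simp [harmonicPoly, MvPolynomial.mem_homogeneousSubmodule]

theorem pderiv_mem_harmonicPoly {m : ℕ} {p : MvPolynomial (Fin n) ℝ} (hp : p ∈ harmonicPoly n m)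
    (i : Fin n) : MvPolynomial.pderiv i p ∈ harmonicPoly n (m - 1) := by
  rw [mem_harmonicPoly] at hp ⊢
  refine ⟨hp.1.pderiv, ?_⟩
  have := congrArg (MvPolynomial.pderiv i) hp.2
  rw [polyLaplacian_apply, map_sum, map_zero] at this
  rw [polyLaplacian_apply, ← this]
  exact Finset.sum_congr rfl fun j _ => by rw [pderiv_comm i j, pderiv_comm i j]

/-- Euler's identity writes `m p` as the sum of `x_i ∂_i p`; integrating by parts turns twice its
integral into that of the Laplacian of `p`. -/
theorem gaussInt_harmonic_eq_zero (hn : 0 < n) {m : ℕ} (hm : 0 < m) {p : MvPolynomial (Fin n) ℝ}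
    (hp : p ∈ harmonicPoly n m) : gaussInt p = 0 := by
  rw [mem_harmonicPoly] at hp
  have h1 : (m : ℝ) • p = ∑ i, MvPolynomial.X i * MvPolynomial.pderiv i p := by
    rw [hp.1.sum_X_mul_pderiv, Nat.cast_smul_eq_nsmul]
  have h2 : 2 * ((m : ℝ) * gaussInt p) = 0 := by
    rw [← gaussInt_smul, h1, gaussInt_sum hn, Finset.mul_sum]
    simp only [gaussInt_X_mul hn]
    rw [← gaussInt_sum hn, ← polyLaplacian_apply, hp.2]
    simp [gaussInt]
  have : (m : ℝ) ≠ 0 := by positivity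
  simpa [this] using h2

/-- Harmonic polynomials are orthogonal, for the Gaussian weight, to polynomials of lower
degree. -/
theorem gaussInt_mul_harmonic_eq_zero (hn : 0 < n) {k m : ℕ} (hkm : k < m)
    {p q : MvPolynomial (Fin n) ℝ} (hq : q.IsHomogeneous k) (hp : p ∈ harmonicPoly n m) :
    gaussInt (q * p) = 0 := by
  induction k using Nat.strong_induction_on generalizing m p q with
  | _ k ih =>
    rcases Nat.eq_zero_or_pos k with rfl | hk
    · rw [← MvPolynomial.totalDegree_zero_iff_isHomogeneous,
        MvPolynomial.totalDegree_eq_zero_iff_eq_C] at hq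
      rw [hq, MvPolynomial.C_mul', gaussInt_smul, gaussInt_harmonic_eq_zero hn hkm hp, mul_zero]
    have h1 : (k : ℝ) • q = ∑ i, MvPolynomial.X i * MvPolynomial.pderiv i q := by
      rw [hq.sum_X_mul_pderiv, Nat.cast_smul_eq_nsmul]
    -- Euler's identity for `q` and integration by parts leave the products `∂_i q · ∂_i p` (degrees
    -- `k-1 < m-1`) and `∂_i ∂_i q · p`, both covered by induction. For `k = 1` the truncated degree
    -- `k - 1 - 1` is 0, still below `k`.
    have h2 : 2 * ((k : ℝ) * gaussInt (q * p)) = 0 := by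
      rw [← gaussInt_smul, ← smul_mul_assoc, h1, Finset.sum_mul, gaussInt_sum hn, Finset.mul_sum]
      refine Finset.sum_eq_zero fun i _ => ?_
      rw [mul_assoc, gaussInt_X_mul hn, Derivation.leibniz, gaussInt_add hn, smul_eq_mul,
        smul_eq_mul, ih (k - 1) (by omega) (by omega) hq.pderiv (pderiv_mem_harmonicPoly hp i),
        zero_add, mul_comm]
      rcases Nat.lt_or_ge 1 k with h | h
      · exact ih (k - 1 - 1) (by omega) (by omega) hq.pderiv.pderiv hp
      · obtain rfl : k = 1 := by omega
        exact ih 0 (by omega) (by omega) (hq.pderiv.pderiv) hp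
    have : (k : ℝ) ≠ 0 := by positivity
    simpa [this] using h2

/-! ### Polar coordinates and orthogonality on the sphere -/

theorem lintegral_polar (hn : 0 < n) (F : E n → ℝ≥0∞) :
    ∫⁻ x, F x = ∫⁻ p, F ((p.2 : ℝ) • (p.1 : E n))
      ∂((volume : Measure (E n)).toSphere.prod (Measure.volumeIoiPow (n - 1))) := by
  have : Nonempty (Fin n) := ⟨⟨0, hn⟩⟩
  have h := (volume : Measure (E n)).measurePreserving_homeomorphUnitSphereProd
  rw [finrank_euclideanSpace, Fintype.card_fin] at h
  conv_lhs => rw [← restrict_compl_singleton (μ := (volume : Measure (E n))) (0 : E n),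
    ← lintegral_subtype_comap (measurableSet_singleton _).compl]
  rw [← h.lintegral_comp_emb (Homeomorph.measurableEmbedding _)]
  refine lintegral_congr fun x => ?_
  have h0 : 0 < ‖(x : E n)‖ := norm_pos_iff.2 x.2
  simp [smul_smul, h0.ne']

theorem integral_polar_mul (hn : 0 < n) {F : E n → ℝ} {f : Sph n → ℝ} {g : ℝ → ℝ}
    (hF : ∀ (e : Sph n) (r : ℝ), 0 < r → F (r • (e : E n)) = f e * g r) :
    ∫ x, F x = (∫ e, f e ∂(volume : Measure (E n)).toSphere) *
      ∫ r, g (r : ℝ) ∂Measure.volumeIoiPow (n - 1) := by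
  have : Nonempty (Fin n) := ⟨⟨0, hn⟩⟩
  have h := (volume : Measure (E n)).measurePreserving_homeomorphUnitSphereProd
  rw [finrank_euclideanSpace, Fintype.card_fin] at h
  conv_lhs => rw [← restrict_compl_singleton (μ := (volume : Measure (E n))) (0 : E n),
    ← integral_subtype_comap (measurableSet_singleton _).compl]
  rw [← integral_prod_mul (L := ℝ) f fun r : Ioi (0 : ℝ) => g r,
    ← h.integral_comp (Homeomorph.measurableEmbedding _)]
  refine integral_congr_ae (Filter.Eventually.of_forall fun x => ?_)
  have h0 : 0 < ‖(x : E n)‖ := norm_pos_iff.2 x.2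
  refine Eq.trans ?_ (hF _ _ (homeomorphUnitSphereProd (E n) x).2.2)
  refine congrArg F ?_
  simp [smul_smul, h0.ne']

theorem integral_pow_mul_exp_volumeIoiPow_ne_zero (hn : 0 < n) (d : ℕ) :
    ∫ r : Ioi (0 : ℝ), (r : ℝ) ^ d * Real.exp (-(r : ℝ) ^ 2) ∂Measure.volumeIoiPow (n - 1) ≠ 0 := by
  have : Nonempty (Fin n) := ⟨⟨0, hn⟩⟩
  intro h0
  have h1 := integral_polar_mul hn (F := fun x : E n => ‖x‖ ^ d * Real.exp (-‖x‖ ^ 2))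
    (f := fun _ => 1) (g := fun r => r ^ d * Real.exp (-r ^ 2)) (fun e r hr => by
      simp [norm_smul, abs_of_pos hr])
  obtain ⟨y, hy⟩ := exists_ne (0 : E n)
  have h2 : 0 < ∫ x : E n, ‖x‖ ^ d * Real.exp (-‖x‖ ^ 2) :=
    integral_pos_of_integrable_nonneg_nonzero (x := y) (by fun_prop)
      (integrable_norm_pow_mul_exp hn d) (fun x => by positivity)
      (by have := norm_pos_iff.2 hy; positivity)
  rw [h1, h0, mul_zero] at h2
  exact h2.false

/-- In polar coordinates the radial factor depends only on the degree and is nonzero, so vanishing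
Gaussian integrals of homogeneous polynomials give vanishing spherical integrals. -/
theorem gaussInt_eq_mul (hn : 0 < n) (d : ℕ) : ∃ c : ℝ, c ≠ 0 ∧
    ∀ p : MvPolynomial (Fin n) ℝ, p.IsHomogeneous d →
      gaussInt p = c * ∫ e, polyRestrict n p e ∂(volume : Measure (E n)).toSphere := by
  refine ⟨_, integral_pow_mul_exp_volumeIoiPow_ne_zero hn d, fun p hp => ?_⟩
  rw [mul_comm, gaussInt]
  refine integral_polar_mul hn (g := fun r => r ^ d * Real.exp (-r ^ 2)) fun e r hr => ?_
  rw [polyEval_smul hp, polyRestrict_apply, norm_smul]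
  simp [abs_of_pos hr]
  ring

/-- The extension of a function on the sphere to a function on the whole space that is constant on
open rays from the origin. -/
def radExt (f : Sph n → ℝ) (x : E n) : ℝ :=
  if h : x = 0 then 0 else f ⟨‖x‖⁻¹ • x, by simp [norm_smul, h]⟩

theorem radExt_smul (f : Sph n → ℝ) {r : ℝ} (hr : 0 < r) (e : Sph n) :
    radExt f (r • (e : E n)) = f e := by
  have he : (e : E n) ≠ 0 := ne_zero_of_mem_unit_sphere e
  rw [radExt, dif_neg (smul_ne_zero hr.ne' he)]
  congr 1
  ext1
  simp [norm_smul, smul_smul, abs_of_pos hr, hr.ne']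

theorem radExt_neg (f : Sph n → ℝ) (x : E n) : radExt f (-x) = radExt (fun e => f (-e)) x := by
  by_cases hx : x = 0
  · simp [radExt, hx]
  · simp only [radExt, neg_eq_zero, hx, dif_neg, not_false_eq_true]
    congr 1
    ext1
    simp

theorem integral_sigma (f : Sph n → ℝ) :
    ∫ e, f e ∂sigma n = (((volume : Measure (E n)).toSphere univ)⁻¹).toReal *
      ∫ e, f e ∂(volume : Measure (E n)).toSphere := by
  rw [sigma, integral_smul_measure, smul_eq_mul]

theorem inner_toL2 (f g : C(Sph n, ℝ)) :
    inner ℝ (toL2 n f) (toL2 n g) = ∫ e, f e * g e ∂sigma n := by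
  rw [toL2, ContinuousMap.inner_toLp]
  simp [mul_comm]

theorem mem_harmonics {m : ℕ} {u : L2 n} :
    u ∈ harmonics n m ↔ ∃ p ∈ harmonicPoly n m, toL2 n (polyRestrict n p) = u := by
  simp [harmonics, Submodule.mem_map]

theorem harmonics_isOrtho_of_lt (hn : 0 < n) {k m : ℕ} (h : k < m) :
    harmonics n k ⟂ harmonics n m := by
  rw [Submodule.isOrtho_iff_inner_eq]
  intro u hu v hv
  obtain ⟨q, hq, rfl⟩ := mem_harmonics.1 hu
  obtain ⟨p, hp, rfl⟩ := mem_harmonics.1 hv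
  obtain ⟨c, hc, H⟩ := gaussInt_eq_mul (n := n) hn (k + m)
  have hq' := (mem_harmonicPoly.1 hq).1
  have h1 := H (q * p) (hq'.mul (mem_harmonicPoly.1 hp).1)
  rw [gaussInt_mul_harmonic_eq_zero hn h hq' hp] at h1
  rw [inner_toL2, integral_sigma]
  have h2 := (mul_eq_zero.1 h1.symm).resolve_left hc
  simp only [map_mul, ContinuousMap.mul_apply] at h2
  rw [h2, mul_zero]

theorem orthogonalFamily_harmonics (hn : 0 < n) :
    OrthogonalFamily ℝ (fun m => harmonics n m) fun m => (harmonics n m).subtypeₗᵢ := by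
  refine OrthogonalFamily.of_pairwise fun k m hkm => ?_
  rcases lt_or_gt_of_ne hkm with h | h
  · exact harmonics_isOrtho_of_lt hn h
  · exact (harmonics_isOrtho_of_lt hn h).symm

/-- Inherited from the invariance of Lebesgue measure under `x ↦ -x`: extend `f` radially, multiply
by a Gaussian and cancel the radial factor. -/
theorem integral_sigma_neg (hn : 0 < n) (f : Sph n → ℝ) :
    ∫ e, f (-e) ∂sigma n = ∫ e, f e ∂sigma n := by
  have key (f : Sph n → ℝ) := integral_polar_mul hn
    (F := fun x : E n => radExt f x * (‖x‖ ^ 0 * Real.exp (-‖x‖ ^ 2)))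
    (f := f) (g := fun r => r ^ 0 * Real.exp (-r ^ 2)) (fun e r hr => by
      rw [radExt_smul f hr]; simp [norm_smul])
  have h := integral_neg_eq_self
    (fun x : E n => radExt f x * (‖x‖ ^ 0 * Real.exp (-‖x‖ ^ 2))) volume
  simp only [radExt_neg, norm_neg] at h
  rw [key, key] at h
  rw [integral_sigma, integral_sigma,
    mul_right_cancel₀ (integral_pow_mul_exp_volumeIoiPow_ne_zero hn 0) h]

/-! ### Completeness of spherical harmonics -/

/-- The squared Euclidean norm as a polynomial. -/
def normSqPoly (n : ℕ) : MvPolynomial (Fin n) ℝ := ∑ i, MvPolynomial.X i ^ 2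

theorem polyEval_normSqPoly (x : E n) : polyEval x (normSqPoly n) = ‖x‖ ^ 2 := by
  simp [normSqPoly, EuclideanSpace.norm_sq_eq]

theorem isHomogeneous_normSqPoly : (normSqPoly n).IsHomogeneous 2 :=
  MvPolynomial.IsHomogeneous.sum _ _ _ fun i _ => MvPolynomial.isHomogeneous_X_pow i 2

theorem polyRestrict_normSqPoly : polyRestrict n (normSqPoly n) = 1 := by
  ext e
  simp [polyRestrict_apply, polyEval_normSqPoly]

theorem isHomogeneous_polyLaplacian {k : ℕ} {p : MvPolynomial (Fin n) ℝ}
    (hp : p.IsHomogeneous (k + 2)) : (polyLaplacian n p).IsHomogeneous k := by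
  rw [polyLaplacian_apply]
  exact MvPolynomial.IsHomogeneous.sum _ _ _ fun i _ => hp.pderiv.pderiv

theorem polyLaplacian_eq_zero {k : ℕ} (hk : k < 2) {p : MvPolynomial (Fin n) ℝ}
    (hp : p.IsHomogeneous k) : polyLaplacian n p = 0 := by
  rw [polyLaplacian_apply]
  refine Finset.sum_eq_zero fun i _ => ?_
  have h : (MvPolynomial.pderiv i p).IsHomogeneous 0 := by
    simpa [show k - 1 = 0 by omega] using hp.pderiv (i := i)
  rw [← MvPolynomial.totalDegree_zero_iff_isHomogeneous,
    MvPolynomial.totalDegree_eq_zero_iff_eq_C] at h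
  rw [h, MvPolynomial.pderiv_C]

theorem eq_zero_of_gaussInt_eq_zero (hn : 0 < n) {q : MvPolynomial (Fin n) ℝ}
    (h : gaussInt (q * (normSqPoly n * q)) = 0) : q = 0 := by
  have : Nonempty (Fin n) := ⟨⟨0, hn⟩⟩
  have hr : normSqPoly n ≠ 0 := fun h0 => by
    obtain ⟨y, hy⟩ := exists_ne (0 : E n)
    have := polyEval_normSqPoly y
    rw [h0, map_zero] at this
    exact hy (norm_eq_zero.1 (pow_eq_zero_iff two_ne_zero |>.1 this.symm))
  suffices h' : normSqPoly n * q = 0 from (mul_eq_zero.1 h').resolve_left hr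
  refine MvPolynomial.funext fun x => ?_
  by_contra hx
  set y : E n := WithLp.toLp 2 x
  have hy : polyEval y (normSqPoly n * q) ≠ 0 := by
    rwa [map_zero, ← MvPolynomial.coe_aeval_eq_eval] at hx
  rw [map_mul, polyEval_normSqPoly] at hy
  refine (integral_pos_of_integrable_nonneg_nonzero (μ := (volume : Measure (E n))) (x := y)
    ((continuous_polyEval _).mul (by fun_prop))
    (integrable_polyEval_mul_exp hn (q * (normSqPoly n * q))) (fun x => ?_) ?_).ne' h
  · simp only [map_mul, polyEval_normSqPoly, Pi.zero_apply, Pi.mul_apply]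
    rw [mul_left_comm]
    exact mul_nonneg (mul_nonneg (sq_nonneg _) (mul_self_nonneg _)) (Real.exp_pos _).le
  · simp only [map_mul, polyEval_normSqPoly]
    exact mul_ne_zero (mul_ne_zero (right_ne_zero_of_mul hy) hy) (Real.exp_pos _).ne'

/-- Every homogeneous polynomial is the sum of a harmonic one and a multiple of `|x|²`. -/
theorem exists_harmonicPoly_add_normSqPoly_mul (hn : 0 < n) {k : ℕ} {p : MvPolynomial (Fin n) ℝ}
    (hp : p.IsHomogeneous (k + 2)) :
    ∃ h ∈ harmonicPoly n (k + 2), ∃ q : MvPolynomial (Fin n) ℝ, q.IsHomogeneous k ∧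
      p = h + normSqPoly n * q := by
  set V := MvPolynomial.homogeneousSubmodule (Fin n) ℝ k
  have hmul {q : MvPolynomial (Fin n) ℝ} (hq : q ∈ V) :
      (normSqPoly n * q).IsHomogeneous (k + 2) := by
    rw [add_comm]; exact isHomogeneous_normSqPoly.mul hq
  -- `q ↦ Δ(|x|² q)` is injective on degree `k`: in its kernel `|x|² q` is harmonic of degree `k +
  -- 2`, hence orthogonal to `q`, which forces `q = 0`. Finite dimension then gives surjectivity.
  let T : V →ₗ[ℝ] V := (polyLaplacian n ∘ₗ LinearMap.mulLeft ℝ (normSqPoly n)).restrict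
    fun q hq => isHomogeneous_polyLaplacian (hmul hq)
  have hT : Function.Injective T := by
    rw [injective_iff_map_eq_zero]
    rintro ⟨q, hq⟩ h
    have h1 : polyLaplacian n (normSqPoly n * q) = 0 := congrArg Subtype.val h
    exact Subtype.ext (eq_zero_of_gaussInt_eq_zero hn
      (gaussInt_mul_harmonic_eq_zero hn (by omega) hq (mem_harmonicPoly.2 ⟨hmul hq, h1⟩)))
  obtain ⟨⟨q, hq⟩, h⟩ := LinearMap.injective_iff_surjective.1 hT
    ⟨polyLaplacian n p, isHomogeneous_polyLaplacian hp⟩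
  have h1 : polyLaplacian n (normSqPoly n * q) = polyLaplacian n p := congrArg Subtype.val h
  refine ⟨p - normSqPoly n * q, mem_harmonicPoly.2 ⟨hp.sub (hmul hq), ?_⟩, q, hq, by ring⟩
  rw [map_sub, h1, sub_self]

theorem toL2_mem_iSup_harmonics (hn : 0 < n) {k : ℕ} {p : MvPolynomial (Fin n) ℝ}
    (hp : p.IsHomogeneous k) : toL2 n (polyRestrict n p) ∈ ⨆ m, harmonics n m := by
  induction k using Nat.strong_induction_on generalizing p with
  | _ k ih =>
    rcases Nat.lt_or_ge k 2 with hk | hk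
    · exact Submodule.mem_iSup_of_mem k (mem_harmonics.2
        ⟨p, mem_harmonicPoly.2 ⟨hp, polyLaplacian_eq_zero hk hp⟩, rfl⟩)
    · obtain ⟨k, rfl⟩ := Nat.exists_eq_add_of_le' hk
      obtain ⟨h, hh, q, hq, rfl⟩ := exists_harmonicPoly_add_normSqPoly_mul hn hp
      rw [map_add, map_mul, polyRestrict_normSqPoly, one_mul, map_add]
      exact add_mem (Submodule.mem_iSup_of_mem (k + 2) (mem_harmonics.2 ⟨h, hh, rfl⟩))
        (ih k (by omega) hq)

theorem polyRestrict_range_topologicalClosure :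
    (polyRestrict n).range.topologicalClosure = ⊤ := by
  refine ContinuousMap.subalgebra_topologicalClosure_eq_top_of_separatesPoints _ ?_
  intro x y hxy
  obtain ⟨i, hi⟩ : ∃ i, (x : E n) i ≠ (y : E n) i := by
    by_contra! h
    exact hxy (Subtype.ext (PiLp.ext h))
  exact ⟨_, ⟨polyRestrict n (MvPolynomial.X i), ⟨_, rfl⟩, rfl⟩, by simpa [polyRestrict_apply]⟩

/-- Stone–Weierstrass makes polynomials uniformly dense in the continuous functions, which are dense
in `L²`; on the sphere the factor `|x|²` is 1, so each homogeneous piece reduces to harmonics. -/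
theorem iSup_harmonics_topologicalClosure (hn : 0 < n) :
    (⨆ m, harmonics n m).topologicalClosure = ⊤ := by
  have h1 : DenseRange (toL2 n) := ContinuousMap.toLp_denseRange ℝ (sigma n) ℝ (by simp)
  have h2 := h1.topologicalClosure_map_submodule
    (s := Subalgebra.toSubmodule (polyRestrict n).range) (by
      exact SetLike.coe_injective (congrArg (fun A : Subalgebra ℝ C(Sph n, ℝ) =>
        (A : Set C(Sph n, ℝ))) polyRestrict_range_topologicalClosure))
  rw [eq_top_iff, ← h2]
  refine Submodule.topologicalClosure_mono ?_
  rintro _ ⟨_, ⟨p, rfl⟩, rfl⟩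
  have hp := MvPolynomial.sum_homogeneousComponent p
  change toL2 n (polyRestrict n p) ∈ _
  rw [← hp, map_sum, map_sum]
  exact sum_mem fun i _ =>
    toL2_mem_iSup_harmonics hn (MvPolynomial.homogeneousComponent_isHomogeneous i p)

theorem hasSum_component (hn : 0 < n) (f : L2 n) : HasSum (fun m => component n m f) f := by
  have hV := orthogonalFamily_harmonics hn
  have hs : IsHilbertSum ℝ (fun m => harmonics n m) fun m => (harmonics n m).subtypeₗᵢ :=
    IsHilbertSum.mkInternal _ hV (iSup_harmonics_topologicalClosure hn).ge
  have h := hs.hasSum_linearIsometryEquiv_symm (hs.linearIsometryEquiv f)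
  rw [LinearIsometryEquiv.symm_apply_apply] at h
  refine h.congr_fun ?_
  intro m
  -- Projecting the Hilbert sum to degree `m` kills every other term, which identifies its `m`-th
  -- term with the component.
  have h1 := h.mapL (harmonics n m).starProjection
  have h2 : HasSum (fun k => (harmonics n m).starProjection
      ((harmonics n k).subtypeₗᵢ (hs.linearIsometryEquiv f k)))
      ((harmonics n m).subtypeₗᵢ (hs.linearIsometryEquiv f m)) := by
    convert hasSum_single (f := fun k => (harmonics n m).starProjection
      ((harmonics n k).subtypeₗᵢ (hs.linearIsometryEquiv f k))) m fun k hk => ?_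
    · exact (Submodule.starProjection_eq_self_iff.2 (hs.linearIsometryEquiv f m).2).symm
    · rw [Submodule.starProjection_apply_eq_zero_iff]
      exact hV.isOrtho hk (hs.linearIsometryEquiv f k).2
  exact h1.unique h2

/-! ### Vanishing of the odd components -/

theorem polyEval_neg {p : MvPolynomial (Fin n) ℝ} {d : ℕ} (hp : p.IsHomogeneous d) (hd : Odd d)
    (x : E n) : polyEval (-x) p = -polyEval x p := by
  rw [← neg_one_smul ℝ x, polyEval_smul hp, hd.neg_one_pow, neg_one_mul]

theorem component_eq_zero_of_even (hn : 0 < n) {m : ℕ} (hm : Odd m) {f : C(Sph n, ℝ)}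
    (hf : ∀ e, f (-e) = f e) : component n m (toL2 n f) = 0 := by
  rw [component, Submodule.starProjection_apply_eq_zero_iff, Submodule.mem_orthogonal]
  intro u hu
  obtain ⟨p, hp, rfl⟩ := mem_harmonics.1 hu
  have h := integral_sigma_neg hn fun e => polyRestrict n p e * f e
  simp only [hf, polyRestrict_apply, Metric.sphere, coe_neg_sphere,
    polyEval_neg (mem_harmonicPoly.1 hp).1 hm, neg_mul, integral_neg] at h
  rw [inner_toL2]
  simp only [polyRestrict_apply]
  linarith

/-! ### Averages over balls and the spherical maximal function -/

theorem volumeIoiPow_Ioo_le (m : ℕ) {a b : ℝ} :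
    Measure.volumeIoiPow m (Subtype.val ⁻¹' Ioo a b) ≤ ENNReal.ofReal (b ^ m * (b - a)) := by
  have hS : MeasurableSet (Subtype.val ⁻¹' Ioo a b : Set (Ioi (0 : ℝ))) :=
    measurable_subtype_coe measurableSet_Ioo
  rcases le_or_gt b 0 with hb | hb
  · have : (Subtype.val ⁻¹' Ioo a b : Set (Ioi (0 : ℝ))) = ∅ := by
      ext r
      simpa using fun _ => hb.trans r.2.out.le
    simp [this]
  rw [Measure.volumeIoiPow, withDensity_apply _ hS, ENNReal.ofReal_mul (by positivity)]
  calc _ ≤ ∫⁻ _ in (Subtype.val ⁻¹' Ioo a b : Set (Ioi (0 : ℝ))), ENNReal.ofReal (b ^ m)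
        ∂(Measure.comap Subtype.val volume) := by
        refine setLIntegral_mono' hS fun r hr => ?_
        have := r.2.out.le
        have := hr.2.le
        gcongr
    _ ≤ _ := by
        rw [setLIntegral_const, comap_subtype_coe_apply measurableSet_Ioi]
        gcongr
        rw [← Real.volume_Ioo]
        exact measure_mono (image_preimage_subset _ _)

theorem le_volumeIoiPow_Ioo (m : ℕ) {a b : ℝ} (ha : 0 ≤ a) :
    ENNReal.ofReal (a ^ m * (b - a)) ≤ Measure.volumeIoiPow m (Subtype.val ⁻¹' Ioo a b) := by
  have hS : MeasurableSet (Subtype.val ⁻¹' Ioo a b : Set (Ioi (0 : ℝ))) :=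
    measurable_subtype_coe measurableSet_Ioo
  rw [Measure.volumeIoiPow, withDensity_apply _ hS, ENNReal.ofReal_mul (by positivity)]
  calc _ ≤ ∫⁻ _ in (Subtype.val ⁻¹' Ioo a b : Set (Ioi (0 : ℝ))), ENNReal.ofReal (a ^ m)
        ∂(Measure.comap Subtype.val volume) := by
        rw [setLIntegral_const, comap_subtype_coe_apply measurableSet_Ioi]
        gcongr
        rw [← Real.volume_Ioo, Subtype.image_preimage_coe, inter_eq_right.2]
        exact fun r hr => ha.trans_lt hr.1
    _ ≤ _ := by
        refine setLIntegral_mono' hS fun r hr => ?_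
        have := hr.1.le
        gcongr

theorem mem_cap_iff {t : ℝ} {e u : Sph n} :
    u ∈ cap t e ↔ ‖(u : E n) - e‖ ^ 2 ≤ 2 * (1 - Real.cos t) := by
  rw [norm_sub_sq_real, cap, mem_ofPred_eq, real_inner_comm]
  simp only [norm_eq_of_mem_sphere]
  constructor <;> intro h <;> linarith

theorem measurableSet_cap (t : ℝ) (e : Sph n) : MeasurableSet (cap t e) := by
  refine IsClosed.measurableSet ?_
  exact isClosed_le continuous_const (by fun_prop)

theorem abs_sub_one_le_norm_smul_sub {e u : Sph n} {r : ℝ} (hr : 0 ≤ r) :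
    |r - 1| ≤ ‖r • (u : E n) - e‖ := by
  simpa [norm_smul, abs_of_nonneg hr] using abs_norm_sub_norm_le (r • (u : E n)) (e : E n)

theorem norm_sub_smul_self (u : Sph n) (r : ℝ) : ‖(u : E n) - r • (u : E n)‖ = |r - 1| := by
  rw [show (u : E n) - r • (u : E n) = (1 - r) • (u : E n) by module, norm_smul]
  simp [abs_sub_comm]

theorem norm_direction_sub_le {e u : Sph n} {r : ℝ} (hr : 0 ≤ r) :
    ‖(u : E n) - e‖ ≤ 2 * ‖r • (u : E n) - e‖ := by
  have h1 := abs_sub_one_le_norm_smul_sub (e := e) (u := u) hr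
  have h2 := norm_sub_smul_self u r
  linarith [norm_sub_le_norm_sub_add_norm_sub (u : E n) (r • (u : E n)) e]

/-- The surface measure of the cap of angular radius `t` is at most of order `t ^ (n - 1)`. -/
theorem toSphere_cap_le (hn : 0 < n) {d t : ℝ} (hd : 0 < d) (hd' : d ≤ 1 / 4)
    (ht : 1 - Real.cos t = 8 * d ^ 2) (e : Sph n) :
    (volume : Measure (E n)).toSphere (cap t e) * ENNReal.ofReal ((1 / 2) ^ (n - 1) * (2 * d)) ≤
      ENNReal.ofReal ((5 * d) ^ n) * volume (ball (0 : E n) 1) := by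
  calc _ ≤ (volume : Measure (E n)).toSphere (cap t e) *
        Measure.volumeIoiPow (n - 1) (Subtype.val ⁻¹' Ioo (1 - d) (1 + d)) := by
        gcongr
        refine le_trans ?_ (le_volumeIoiPow_Ioo (n - 1) (by linarith))
        have : 0 ≤ 1 - d := by linarith
        gcongr
        · linarith
        · linarith
    _ = ((volume : Measure (E n)).toSphere.prod (Measure.volumeIoiPow (n - 1)))
        (cap t e ×ˢ (Subtype.val ⁻¹' Ioo (1 - d) (1 + d))) := (Measure.prod_prod _ _).symm
    _ ≤ volume (ball (e : E n) (5 * d)) := by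
        rw [← lintegral_indicator_one measurableSet_ball, lintegral_polar hn,
          ← lintegral_indicator_one ((measurableSet_cap t e).prod
            (measurable_subtype_coe measurableSet_Ioo))]
        refine lintegral_mono fun p => ?_
        refine indicator_apply_le' (fun hp => ?_) fun _ => zero_le
        -- The hypothesis on `t` says that the cap has chordal radius `4d`; a radial displacement of
        -- less than `d` keeps the points within `5d` of `e`.
        have h1 : ‖(p.1 : E n) - e‖ ^ 2 ≤ (4 * d) ^ 2 := by
          have := mem_cap_iff.1 hp.1
          rw [ht] at this
          linarith
        have h2 : |(p.2 : ℝ) - 1| < d := abs_lt.2 ⟨by linarith [hp.2.1], by linarith [hp.2.2]⟩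
        have h3 := norm_sub_smul_self p.1 (p.2 : ℝ)
        have h4 := norm_sub_le_norm_sub_add_norm_sub ((p.2 : ℝ) • (p.1 : E n)) (p.1 : E n) e
        rw [norm_sub_rev _ (p.1 : E n), h3] at h4
        have h5 := abs_le_of_sq_le_sq h1 (by positivity)
        rw [abs_norm] at h5
        rw [indicator_of_mem, Pi.one_apply, Pi.one_apply]
        rw [mem_ball_iff_norm]
        linarith
    _ = _ := by
        rw [Measure.addHaar_ball_of_pos _ _ (by positivity)]
        simp

/-- A point `r u` of the ball has `|r - 1| < 2d` and direction within `4d` of `e`, so the ball lies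
over the cap of chordal radius `4d`. There the factor `|x| = r` is at most 2. -/
theorem lintegral_ball_le (hn : 0 < n) {d t : ℝ} (hd : 0 < d) (hd' : d ≤ 1 / 4)
    (ht : 1 - Real.cos t = 8 * d ^ 2) (e : Sph n) {k : Sph n → ℝ} (hk : Measurable k) :
    ∫⁻ x in ball (e : E n) (2 * d), ENNReal.ofReal |‖x‖ * radExt k x| ≤
      ENNReal.ofReal (2 ^ (n - 1) * (8 * d)) *
        ∫⁻ u in cap t e, ENNReal.ofReal |k u| ∂(volume : Measure (E n)).toSphere := by
  have hS : MeasurableSet (Subtype.val ⁻¹' Ioo (1 - 2 * d) (1 + 2 * d) : Set (Ioi (0 : ℝ))) :=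
    measurable_subtype_coe measurableSet_Ioo
  calc _ = ∫⁻ p, (ball (e : E n) (2 * d)).indicator
        (fun x => ENNReal.ofReal |‖x‖ * radExt k x|) ((p.2 : ℝ) • (p.1 : E n))
        ∂((volume : Measure (E n)).toSphere.prod (Measure.volumeIoiPow (n - 1))) := by
        rw [← lintegral_indicator measurableSet_ball, lintegral_polar hn]
    _ ≤ ∫⁻ p, (cap t e).indicator (fun u => ENNReal.ofReal |k u|) p.1 *
        (Subtype.val ⁻¹' Ioo (1 - 2 * d) (1 + 2 * d)).indicator (fun _ => 2) p.2
        ∂((volume : Measure (E n)).toSphere.prod (Measure.volumeIoiPow (n - 1))) := by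
        refine lintegral_mono fun p => indicator_apply_le' (fun hp => ?_) fun _ => zero_le
        rw [mem_ball_iff_norm] at hp
        have hr : (0 : ℝ) < p.2 := p.2.2
        have h1 := norm_direction_sub_le (e := e) (u := p.1) hr.le
        have h2 := abs_lt.1 ((abs_sub_one_le_norm_smul_sub (e := e) (u := p.1) hr.le).trans_lt hp)
        have h3 : p.1 ∈ cap t e := by
          rw [mem_cap_iff, ht]
          nlinarith [norm_nonneg ((p.1 : E n) - e)]
        have h4 : p.2 ∈ (Subtype.val ⁻¹' Ioo (1 - 2 * d) (1 + 2 * d) : Set (Ioi (0 : ℝ))) :=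
          ⟨by linarith, by linarith⟩
        rw [indicator_of_mem h3, indicator_of_mem h4, radExt_smul k hr, abs_mul, abs_norm,
          mul_comm, ENNReal.ofReal_mul (abs_nonneg _), norm_smul]
        gcongr
        refine ENNReal.ofReal_le_of_le_toReal ?_
        simp only [norm_eq_of_mem_sphere, Real.norm_eq_abs, abs_of_pos hr]
        norm_num
        linarith
    _ = (∫⁻ u in cap t e, ENNReal.ofReal |k u| ∂(volume : Measure (E n)).toSphere) *
        (2 * Measure.volumeIoiPow (n - 1) (Subtype.val ⁻¹' Ioo (1 - 2 * d) (1 + 2 * d))) := by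
        rw [lintegral_prod_mul, lintegral_indicator (measurableSet_cap t e),
          lintegral_indicator_const hS]
        · exact ((hk.abs.ennreal_ofReal).indicator (measurableSet_cap t e)).aemeasurable
        · exact (measurable_const.indicator hS).aemeasurable
    _ ≤ _ := by
        rw [mul_comm]
        gcongr
        calc _ ≤ 2 * ENNReal.ofReal ((1 + 2 * d) ^ (n - 1) * (1 + 2 * d - (1 - 2 * d))) := by
              gcongr
              exact volumeIoiPow_Ioo_le _
          _ = ENNReal.ofReal (2 * ((1 + 2 * d) ^ (n - 1) * (1 + 2 * d - (1 - 2 * d)))) := by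
              rw [ENNReal.ofReal_mul two_pos.le, ENNReal.ofReal_ofNat]
          _ ≤ _ := by
              refine ENNReal.ofReal_le_ofReal ?_
              rw [show 2 * ((1 + 2 * d) ^ (n - 1) * (1 + 2 * d - (1 - 2 * d))) =
                (1 + 2 * d) ^ (n - 1) * (8 * d) by ring]
              gcongr
              linarith

theorem setLIntegral_cap_le_maximal {t : ℝ} (ht : t ∈ Ioc 0 Real.pi) (e : Sph n) (k : Sph n → ℝ) :
    ∫⁻ u in cap t e, ENNReal.ofReal |k u| ∂(volume : Measure (E n)).toSphere ≤
      (volume : Measure (E n)).toSphere (cap t e) * maximal k e := by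
  set τ := (volume : Measure (E n)).toSphere
  rcases eq_or_ne (τ (cap t e)) 0 with h0 | h0
  · rw [setLIntegral_measure_zero _ _ h0]; exact zero_le
  have hu : τ univ ≠ 0 := fun h => h0 (measure_mono_null (subset_univ _) h)
  have hm : (sigma n (cap t e))⁻¹ * ∫⁻ x in cap t e, ENNReal.ofReal |k x| ∂(sigma n) ≤
      maximal k e := by
    rw [maximal]
    exact le_iSup₂_of_le t ht le_rfl
  calc _ = τ (cap t e) * ((sigma n (cap t e))⁻¹ *
        ∫⁻ x in cap t e, ENNReal.ofReal |k x| ∂(sigma n)) := by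
        have h1 : (τ univ)⁻¹ ≠ 0 := ENNReal.inv_ne_zero.2 (measure_ne_top _ _)
        have h2 : (τ univ)⁻¹ ≠ ∞ := ENNReal.inv_ne_top.2 hu
        simp only [sigma, Measure.smul_apply, smul_eq_mul, Measure.restrict_smul,
          lintegral_smul_measure]
        change _ = τ (cap t e) * (((τ univ)⁻¹ * τ (cap t e))⁻¹ * ((τ univ)⁻¹ * _))
        rw [ENNReal.mul_inv (.inl h1) (.inl h2), mul_mul_mul_comm, ENNReal.inv_mul_cancel h1 h2,
          one_mul, ← mul_assoc, ENNReal.mul_inv_cancel h0 (measure_ne_top _ _), one_mul]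
    _ ≤ _ := by gcongr

/-- The cap integral is at most the cap measure times the maximal function, and the cap measure is
bounded by a ball volume. The radial factors of the two comparisons differ by `4 ^ n`, whence `20 =
4 · 5`. -/
theorem lintegral_ball_le_maximal (hn : 0 < n) {d : ℝ} (hd : 0 < d) (hd' : d ≤ 1 / 4)
    (e : Sph n) {k : Sph n → ℝ} (hk : Measurable k) :
    ∫⁻ x in ball (e : E n) (2 * d), ENNReal.ofReal |‖x‖ * radExt k x| ≤
      ENNReal.ofReal ((20 * d) ^ n) * volume (ball (0 : E n) 1) * maximal k e := by
  have hcos : Real.cos (Real.arccos (1 - 8 * d ^ 2)) = 1 - 8 * d ^ 2 :=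
    Real.cos_arccos (by nlinarith) (by nlinarith)
  have ht : Real.arccos (1 - 8 * d ^ 2) ∈ Ioc 0 Real.pi :=
    ⟨Real.arccos_pos.2 (by nlinarith), Real.arccos_le_pi _⟩
  set t := Real.arccos (1 - 8 * d ^ 2)
  have hcap := toSphere_cap_le hn hd hd' (t := t) (by rw [hcos]; ring) e
  calc _ ≤ _ := lintegral_ball_le hn hd hd' (t := t) (by rw [hcos]; ring) e hk
    _ ≤ ENNReal.ofReal (2 ^ (n - 1) * (8 * d)) *
        ((volume : Measure (E n)).toSphere (cap t e) * maximal k e) := by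
        gcongr
        exact setLIntegral_cap_le_maximal ht e k
    _ = ENNReal.ofReal (4 ^ n) * ((volume : Measure (E n)).toSphere (cap t e) *
        ENNReal.ofReal ((1 / 2) ^ (n - 1) * (2 * d))) * maximal k e := by
        have : (2 : ℝ) ^ (n - 1) * (8 * d) = 4 ^ n * ((1 / 2) ^ (n - 1) * (2 * d)) := by
          obtain ⟨m, rfl⟩ := Nat.exists_eq_add_of_lt hn
          simp only [zero_add, Nat.add_sub_cancel, pow_succ, one_div, inv_pow]
          rw [show (4 : ℝ) = 2 * 2 by norm_num, mul_pow]
          field_simp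
          ring
        rw [this, ENNReal.ofReal_mul (by positivity)]
        ring
    _ ≤ ENNReal.ofReal (4 ^ n) * (ENNReal.ofReal ((5 * d) ^ n) * volume (ball (0 : E n) 1)) *
        maximal k e := by gcongr
    _ = _ := by
        rw [← mul_assoc, ← ENNReal.ofReal_mul (by positivity), ← mul_pow]
        ring_nf

/-- Change of variables `x = a + τ v`: the Jacobian `|τ|^{-n}` is at most `r^{-n}`, and the image of
the unit ball lies in the ball about `b`. -/
theorem lintegral_unit_ball_comp_le {F : E n → ℝ≥0∞} (hF : Measurable F) {r τ R : ℝ} (hr : 0 < r)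
    (hτ : r ≤ |τ|) {a b : E n} (hab : dist a b + |τ| ≤ R) :
    ENNReal.ofReal (r ^ n) * ∫⁻ v in ball (0 : E n) 1, F (a + τ • v) ≤ ∫⁻ x in ball b R, F x := by
  have h0 : τ ≠ 0 := by rintro rfl; simp at hτ; linarith
  have hpos : 0 < |τ| := hr.trans_le hτ
  have hmeas : Measurable fun x => (ball b R).indicator F (a + x) :=
    (hF.indicator measurableSet_ball).comp (measurable_const_add a)
  have h1 : ∫⁻ v, (ball b R).indicator F (a + τ • v) =
      ENNReal.ofReal |(τ ^ n)⁻¹| * ∫⁻ x in ball b R, F x := by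
    rw [← lintegral_map (f := fun x => (ball b R).indicator F (a + x)) hmeas
      (measurable_const_smul τ), Measure.map_addHaar_smul _ h0, lintegral_smul_measure,
      lintegral_add_left_eq_self, lintegral_indicator measurableSet_ball]
    simp
  have h2 : ∫⁻ v in ball (0 : E n) 1, F (a + τ • v) ≤
      ∫⁻ v, (ball b R).indicator F (a + τ • v) := by
    rw [← lintegral_indicator measurableSet_ball]
    refine lintegral_mono fun v => indicator_apply_le' (fun hv => ?_) fun _ => zero_le
    rw [indicator_of_mem]
    rw [mem_ball_zero_iff] at hv
    have h3 : dist (a + τ • v) a < |τ| := by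
      rw [dist_self_add_left, norm_smul, Real.norm_eq_abs]
      exact mul_lt_of_lt_one_right hpos hv
    rw [mem_ball]
    linarith [dist_triangle (a + τ • v) a b]
  calc _ ≤ ENNReal.ofReal (r ^ n) *
        (ENNReal.ofReal |(τ ^ n)⁻¹| * ∫⁻ x in ball b R, F x) := by
        gcongr
        exact h2.trans h1.le
    _ = ENNReal.ofReal (r ^ n * |(τ ^ n)⁻¹|) * ∫⁻ x in ball b R, F x := by
        rw [← mul_assoc, ← ENNReal.ofReal_mul (by positivity)]
    _ ≤ 1 * ∫⁻ x in ball b R, F x := by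
        gcongr
        rw [← ENNReal.ofReal_one]
        refine ENNReal.ofReal_le_ofReal ?_
        rw [abs_inv, abs_pow, ← div_eq_mul_inv]
        exact div_le_one_of_le₀ (by gcongr) (by positivity)
    _ = _ := one_mul _

/-! ### Support and radial functions -/

/-- The support function of a convex body on the whole space. -/
def supportFun (K : ConvexBody (E n)) (x : E n) : ℝ :=
  sSup ((fun y : E n => inner ℝ y x) '' (K : Set (E n)))

theorem support_apply (K : ConvexBody (E n)) (e : Sph n) : support K e = supportFun K e := rfl

theorem inner_le_supportFun (K : ConvexBody (E n)) {y : E n} (hy : y ∈ K) (x : E n) :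
    inner ℝ y x ≤ supportFun K x :=
  le_csSup (K.isCompact.image (by fun_prop)).bddAbove ⟨y, hy, rfl⟩

theorem supportFun_le {K : ConvexBody (E n)} {x : E n} {a : ℝ} (h : ∀ y ∈ K, inner ℝ y x ≤ a) :
    supportFun K x ≤ a :=
  csSup_le (K.nonempty.image _) (by rintro _ ⟨y, hy, rfl⟩; exact h y hy)

theorem supportFun_add_le (K : ConvexBody (E n)) (x y : E n) :
    supportFun K (x + y) ≤ supportFun K x + supportFun K y :=
  supportFun_le fun z hz => by
    rw [inner_add_right]
    exact add_le_add (inner_le_supportFun K hz x) (inner_le_supportFun K hz y)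

theorem supportFun_smul (K : ConvexBody (E n)) {t : ℝ} (ht : 0 < t) (x : E n) :
    supportFun K (t • x) = t * supportFun K x := by
  refine le_antisymm (supportFun_le fun z hz => ?_) ?_
  · rw [inner_smul_right]
    exact mul_le_mul_of_nonneg_left (inner_le_supportFun K hz x) ht.le
  · rw [← le_div_iff₀' ht]
    refine supportFun_le fun z hz => ?_
    rw [le_div_iff₀' ht, ← inner_smul_right]
    exact inner_le_supportFun K hz _

theorem IsSymmBody.zero_mem {K : ConvexBody (E n)} (hK : IsSymmBody K) : (0 : E n) ∈ K := by
  obtain ⟨x, hx⟩ := K.nonempty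
  have := K.convex hx (hK.neg_mem x hx) (by norm_num : (0 : ℝ) ≤ 1 / 2)
    (by norm_num : (0 : ℝ) ≤ 1 / 2) (by norm_num)
  simpa using this

theorem IsSymmBody.support_neg {K : ConvexBody (E n)} (hK : IsSymmBody K) (e : Sph n) :
    support K (-e) = support K e := by
  have h (x : E n) : supportFun K (-x) ≤ supportFun K x := supportFun_le fun z hz => by
    rw [inner_neg_right, ← inner_neg_left]
    exact inner_le_supportFun K (hK.neg_mem z hz) x
  rw [support_apply, support_apply, coe_neg_sphere]
  exact le_antisymm (h e) (by simpa using h (-e))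

theorem radial_nonneg (K : ConvexBody (E n)) (e : Sph n) : 0 ≤ radial K e :=
  Real.sSup_nonneg fun _ ht => ht.1.le

theorem le_support_of_smul_mem {K : ConvexBody (E n)} {e : Sph n} {t : ℝ}
    (ht : t • (e : E n) ∈ K) : t ≤ support K e := by
  have := inner_le_supportFun K ht (e : E n)
  rwa [real_inner_smul_left, real_inner_self_eq_norm_sq, norm_eq_of_mem_sphere, one_pow,
    mul_one] at this

theorem IsSymmBody.radial_le_support {K : ConvexBody (E n)} (hK : IsSymmBody K) (e : Sph n) :
    radial K e ≤ support K e :=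
  Real.sSup_le (fun _ ht => le_support_of_smul_mem ht.2)
    (le_support_of_smul_mem (t := 0) (by simpa using hK.zero_mem))

/-- A point of a ray beyond the radial function is separated from the body. -/
theorem IsSymmBody.exists_support_lt {K : ConvexBody (E n)} (hK : IsSymmBody K) {e : Sph n} {s : ℝ}
    (hs : radial K e < s) : ∃ u : Sph n, support K u < s * inner ℝ (e : E n) (u : E n) := by
  have hs0 : 0 < s := (radial_nonneg K e).trans_lt hs
  have hmem : s • (e : E n) ∉ (K : Set (E n)) := fun h =>
    -- The set defining `radial` is bounded above by the support function, so a point of it cannot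
    -- exceed its supremum.
    hs.not_ge (le_csSup ⟨support K e, fun _ ht => le_support_of_smul_mem ht.2⟩ ⟨hs0, h⟩)
  obtain ⟨f, a, h1, h2⟩ := geometric_hahn_banach_closed_point K.convex K.isClosed hmem
  set w := (InnerProductSpace.toDual ℝ (E n)).symm f
  have hf (x : E n) : f x = inner ℝ w x := (InnerProductSpace.toDual_symm_apply).symm
  have ha : 0 < a := by simpa using h1 0 hK.zero_mem
  have hw : w ≠ 0 := fun h => by
    rw [hf, h, inner_zero_left] at h2
    linarith
  have hw' : 0 < ‖w‖ := norm_pos_iff.2 hw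
  refine ⟨⟨‖w‖⁻¹ • w, by simp [norm_smul, hw]⟩, ?_⟩
  have h3 : supportFun K w ≤ a := supportFun_le fun y hy => by
    rw [real_inner_comm, ← hf]; exact (h1 y hy).le
  rw [hf, real_inner_smul_right, real_inner_comm] at h2
  rw [support_apply]
  simp only
  rw [supportFun_smul K (inv_pos.2 hw'), real_inner_smul_right, mul_left_comm]
  exact mul_lt_mul_of_pos_left (h3.trans_lt h2) (inv_pos.2 hw')

theorem exists_eq_smul_sphere {x : E n} (hx : x ≠ 0) : ∃ u : Sph n, x = ‖x‖ • (u : E n) :=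
  ⟨⟨‖x‖⁻¹ • x, by simp [norm_smul, hx]⟩, by simp [smul_smul, hx]⟩

/-! ### The local estimate by second differences -/

/-- Second order comparison of the values of the support function at two points. -/
theorem supportFun_sub_le (K : ConvexBody (E n)) (e u v : E n) (r : ℝ) :
    supportFun K e - supportFun K u ≤
      (supportFun K (e + r • v) + supportFun K (e + (-r) • v)) / 2 -
        2 * supportFun K (u + r • v) + supportFun K (u + (2 * r) • v) := by
  -- `e` is the midpoint of `e ± rv`, and `u + rv` is the midpoint of `u` and `u + 2rv`. The first
  -- midpoint inequality bounds the value at `e` above, the second bounds the value at `u` below.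
  have h1 := supportFun_add_le K (e + r • v) (e + (-r) • v)
  rw [show e + r • v + (e + (-r) • v) = (2 : ℝ) • e by module, supportFun_smul K two_pos] at h1
  have h2 := supportFun_add_le K u (u + (2 * r) • v)
  rw [show u + (u + (2 * r) • v) = (2 : ℝ) • (u + r • v) by module,
    supportFun_smul K two_pos] at h2
  linarith

/-- The norm is bounded above to second order by `N ≤ (1 + N²)/2`, and below by its linearization at
`u`. Constant and linear terms cancel, leaving `r²/2 + 2r²`. -/
theorem norm_second_difference_le {e u v : E n} (he : ‖e‖ = 1) (hu : ‖u‖ = 1) (hv : ‖v‖ ≤ 1)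
    (r : ℝ) :
    (‖e + r • v‖ + ‖e + (-r) • v‖) / 2 - 2 * ‖u + r • v‖ + ‖u + (2 * r) • v‖ ≤ 5 / 2 * r ^ 2 := by
  have upper {a : E n} (ha : ‖a‖ = 1) (t : ℝ) :
      ‖a + t • v‖ ≤ 1 + t * inner ℝ a v + t ^ 2 / 2 := by
    have h1 : ‖a + t • v‖ ^ 2 = 1 + 2 * (t * inner ℝ a v) + t ^ 2 * ‖v‖ ^ 2 := by
      rw [norm_add_sq_real, ha, real_inner_smul_right, norm_smul, mul_pow, Real.norm_eq_abs, sq_abs,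
        one_pow]
    have h2 : t ^ 2 * ‖v‖ ^ 2 ≤ t ^ 2 :=
      mul_le_of_le_one_right (sq_nonneg t) (pow_le_one₀ (norm_nonneg v) hv)
    nlinarith [sq_nonneg (‖a + t • v‖ - 1)]
  have lower : 1 + r * inner ℝ u v ≤ ‖u + r • v‖ := by
    have := real_inner_le_norm u (u + r • v)
    rwa [inner_add_right, real_inner_smul_right, real_inner_self_eq_norm_sq, hu, one_pow,
      one_mul] at this
  linarith [upper he r, upper he (-r), upper hu (2 * r)]

theorem abs_norm_mul_radExt_sub_le {q : Sph n → ℝ} {Λ : ℝ} (hq : ∀ u, |q u| ≤ Λ)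
    (hL : ∀ u w : Sph n, |q u - q w| ≤ Λ * ‖(u : E n) - w‖) {e : Sph n} {x : E n} (hx : x ≠ 0) :
    |‖x‖ * radExt q x - q e| ≤ 3 * Λ * ‖x - e‖ := by
  obtain ⟨u, hu⟩ := exists_eq_smul_sphere hx
  have hx' := norm_pos_iff.2 hx
  have h1 := abs_sub_one_le_norm_smul_sub (e := e) (u := u) hx'.le
  have h2 := norm_direction_sub_le (e := e) (u := u) hx'.le
  have h3 : radExt q x = q u := by
    conv_lhs => rw [hu]
    exact radExt_smul q hx' u
  rw [← hu] at h1 h2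
  have hΛ : 0 ≤ Λ := (abs_nonneg _).trans (hq e)
  calc |‖x‖ * radExt q x - q e| = |(‖x‖ - 1) * q u + (q u - q e)| := by rw [h3]; ring_nf
    _ ≤ |‖x‖ - 1| * |q u| + |q u - q e| := by rw [← abs_mul]; exact abs_add_le _ _
    _ ≤ ‖x - e‖ * Λ + Λ * (2 * ‖x - e‖) := by
        gcongr
        · exact hq u
        · exact (hL u e).trans (by gcongr)
    _ = _ := by ring

theorem measurable_norm_mul_radExt (k : C(Sph n, ℝ)) :
    Measurable fun x : E n => ‖x‖ * radExt k x := by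
  refine measurable_norm.mul (measurable_of_measurable_on_compl_singleton 0 ?_)
  have h (x : ({x | x ≠ 0} : Set (E n))) : radExt k x =
      k ⟨‖(x : E n)‖⁻¹ • (x : E n), by simp [norm_smul, show (x : E n) ≠ 0 from x.2]⟩ :=
    dif_neg x.2
  refine Continuous.measurable (Continuous.congr (k.continuous.comp (Continuous.subtype_mk ?_ _))
    fun x => (h x).symm)
  exact (continuous_norm.comp continuous_subtype_val).inv₀ (fun x => norm_ne_zero_iff.2 x.2) |>.smul
    continuous_subtype_val

/-- The second-order comparison is averaged over `v` in the unit ball with `r = d/10`. The loss `c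
d²/40` from the constant part must stay below the gain `s d²/2` from separation, which is why `r` is
a small multiple of `d`. -/
theorem support_sub_le_add_maximal (hn : 0 < n) (K : ConvexBody (E n)) {c Λ : ℝ} (hc : 0 ≤ c)
    {q k : C(Sph n, ℝ)} (hK : ∀ u, support K u = c + q u + k u) (hq : ∀ u, |q u| ≤ Λ)
    (hL : ∀ u w : Sph n, |q u - q w| ≤ Λ * ‖(u : E n) - w‖)
    {e u : Sph n} {d : ℝ} (hd : 0 < d) (hd' : d ≤ 1 / 4) (hed : ‖(u : E n) - e‖ = d) :
    ENNReal.ofReal (support K e - support K u - c * d ^ 2 / 40 - 24 * Λ * d) ≤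
      ENNReal.ofReal (5 * 200 ^ n) * maximal k e := by
  set W : E n → ℝ≥0∞ := fun x => ENNReal.ofReal |‖x‖ * radExt k x|
  have hW : Measurable W := (measurable_norm_mul_radExt k).abs.ennreal_ofReal
  set r := d / 10 with hr
  have hr0 : 0 < r := by positivity
  have hu1 : ‖(u : E n)‖ = 1 := norm_eq_of_mem_sphere u
  have he1 : ‖(e : E n)‖ = 1 := norm_eq_of_mem_sphere e
  set β := volume (ball (0 : E n) 1)
  have hβ0 : β ≠ 0 := (measure_ball_pos _ _ one_pos).ne'
  have hβ : β ≠ ∞ := measure_ball_lt_top.ne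
  -- The bound for one of the averages of the rough part.
  have hav {a : E n} {τ : ℝ} (hτ : r ≤ |τ|) (ha : dist a e + |τ| ≤ 2 * d) :
      ∫⁻ v in ball (0 : E n) 1, W (a + τ • v) ≤
        ENNReal.ofReal (200 ^ n) * β * maximal k e := by
    have h1 := (lintegral_unit_ball_comp_le hW hr0 hτ ha).trans
      (lintegral_ball_le_maximal hn hd hd' e k.continuous.measurable)
    -- The origin of 200: the ball bound carries `(20d)^n`, and `d = 10r`.
    have h2 : (20 * d) ^ n = r ^ n * 200 ^ n := by rw [← mul_pow, hr]; ring
    rw [h2, ENNReal.ofReal_mul (by positivity), mul_assoc, mul_assoc] at h1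
    rw [mul_assoc]
    exact (ENNReal.mul_le_mul_iff_right (by simpa using pow_pos hr0 n) ENNReal.ofReal_ne_top).1 h1
  have hdecomp {x : E n} (hx : ‖x - e‖ ≤ 2 * d) :
      |supportFun K x - c * ‖x‖ - q e| ≤ 3 * Λ * (2 * d) + |‖x‖ * radExt k x| := by
    have hx0 : x ≠ 0 := by
      rintro rfl
      rw [zero_sub, norm_neg, he1] at hx
      linarith
    have hx' := norm_pos_iff.2 hx0
    obtain ⟨w, hw⟩ := exists_eq_smul_sphere hx0
    have h1 : supportFun K x = ‖x‖ * (c + radExt q x + radExt k x) := by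
      have h2 (f : Sph n → ℝ) : radExt f x = f w := by
        conv_lhs => rw [hw]
        exact radExt_smul f hx' w
      rw [h2, h2, ← hK, support_apply]
      conv_lhs => rw [hw]
      exact supportFun_smul K hx' _
    have h3 := abs_norm_mul_radExt_sub_le hq hL (e := e) hx0
    have hΛ : 0 ≤ Λ := (abs_nonneg _).trans (hq e)
    calc |supportFun K x - c * ‖x‖ - q e|
        = |(‖x‖ * radExt q x - q e) + ‖x‖ * radExt k x| := by rw [h1]; ring_nf
      _ ≤ |‖x‖ * radExt q x - q e| + |‖x‖ * radExt k x| := abs_add_le _ _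
      _ ≤ _ := by
        gcongr
        exact h3.trans (by gcongr)
  have hpt {v : E n} (hv : v ∈ ball (0 : E n) 1) :
      ENNReal.ofReal (support K e - support K u - c * d ^ 2 / 40 - 24 * Λ * d) ≤
        W ((e : E n) + r • v) + W ((e : E n) + (-r) • v) + 2 * W ((u : E n) + r • v) +
          W ((u : E n) + (2 * r) • v) := by
    rw [mem_ball_zero_iff] at hv
    have hnear {a : E n} {τ : ℝ} (ha : ‖a - e‖ + |τ| ≤ 2 * d) : ‖a + τ • v - e‖ ≤ 2 * d := by
      have h1 : ‖τ • v‖ ≤ |τ| := by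
        rw [norm_smul, Real.norm_eq_abs]
        exact mul_le_of_le_one_right (abs_nonneg τ) hv.le
      have h2 := norm_add_le (a - e) (τ • v)
      rw [show a + τ • v - e = a - e + τ • v by abel]
      linarith
    have he0 : ‖(e : E n) - e‖ = 0 := by simp
    have a1 := abs_le.1 (hdecomp (hnear (a := e) (τ := r) (by
      rw [abs_of_pos hr0, he0]; linarith)))
    have a2 := abs_le.1 (hdecomp (hnear (a := e) (τ := -r) (by
      rw [abs_neg, abs_of_pos hr0, he0]; linarith)))
    have a3 := abs_le.1 (hdecomp (hnear (a := u) (τ := r) (by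
      rw [abs_of_pos hr0, hed]; linarith)))
    have a4 := abs_le.1 (hdecomp (hnear (a := u) (τ := 2 * r) (by
      rw [abs_of_pos (by positivity), hed]; linarith)))
    have h5 := mul_le_mul_of_nonneg_left (norm_second_difference_le he1 hu1 hv.le r) hc
    have h6 := supportFun_sub_le K e u v r
    have h7 : 5 / 2 * r ^ 2 = d ^ 2 / 40 := by rw [hr]; ring
    rw [h7] at h5
    have n1 := abs_nonneg (‖(e : E n) + r • v‖ * radExt k ((e : E n) + r • v))
    have n2 := abs_nonneg (‖(e : E n) + (-r) • v‖ * radExt k ((e : E n) + (-r) • v))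
    have n3 := abs_nonneg (‖(u : E n) + r • v‖ * radExt k ((u : E n) + r • v))
    have n4 := abs_nonneg (‖(u : E n) + (2 * r) • v‖ * radExt k ((u : E n) + (2 * r) • v))
    simp only [W]
    rw [two_mul (ENNReal.ofReal _), ← ENNReal.ofReal_add n1 n2, ← ENNReal.ofReal_add n3 n3,
      ← ENNReal.ofReal_add (add_nonneg n1 n2) (add_nonneg n3 n3),
      ← ENNReal.ofReal_add (add_nonneg (add_nonneg n1 n2) (add_nonneg n3 n3)) n4]
    refine ENNReal.ofReal_le_ofReal ?_
    rw [support_apply, support_apply]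
    linarith [a1.2, a2.2, a3.1, a4.2]
  have hint := setLIntegral_mono' (μ := (volume : Measure (E n))) measurableSet_ball
    fun v hv => hpt hv
  rw [setLIntegral_const] at hint
  have hm (a : E n) (τ : ℝ) : Measurable fun v => W (a + τ • v) :=
    hW.comp ((measurable_const_smul τ).const_add a)
  rw [lintegral_add_right _ (hm _ _), lintegral_add_right _ ((hm _ _).const_mul 2),
    lintegral_add_right _ (hm _ _), lintegral_const_mul _ (hm _ _)] at hint
  have he0 : dist (e : E n) e = 0 := dist_self _
  have hu0 : dist (u : E n) e = d := by rw [dist_eq_norm, hed]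
  have b1 := hav (a := e) (τ := r) (by rw [abs_of_pos hr0])
    (by rw [abs_of_pos hr0, he0]; linarith)
  have b2 := hav (a := e) (τ := -r) (by rw [abs_neg, abs_of_pos hr0])
    (by rw [abs_neg, abs_of_pos hr0, he0]; linarith)
  have b3 := hav (a := u) (τ := r) (by rw [abs_of_pos hr0])
    (by rw [abs_of_pos hr0, hu0]; linarith)
  have b4 := hav (a := u) (τ := 2 * r) (by rw [abs_of_pos (by positivity)]; linarith)
    (by rw [abs_of_pos (by positivity), hu0]; linarith)
  set A := ENNReal.ofReal (200 ^ n) * β * maximal k e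
  have hfin := hint.trans (add_le_add (add_le_add (add_le_add b1 b2) (mul_le_mul_right b3 2)) b4)
  -- The four averages enter with weights `1 + 1 + 2 + 1 = 5`, the two weights `1/2` having been
  -- rounded up to 1.
  rw [show A + A + 2 * A + A = (ENNReal.ofReal (5 * 200 ^ n) * maximal k e) * β by
    rw [ENNReal.ofReal_mul (by norm_num)]; simp only [A, ENNReal.ofReal_ofNat]; ring] at hfin
  exact (ENNReal.mul_le_mul_iff_left hβ0 hβ).1 hfin

/-! ### Lipschitz control of the low-degree part -/

theorem isProbabilityMeasure_sigma (hn : 0 < n) : IsProbabilityMeasure (sigma n) := by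
  have : Nonempty (Fin n) := ⟨⟨0, hn⟩⟩
  constructor
  rw [sigma, Measure.smul_apply, smul_eq_mul]
  exact ENNReal.inv_mul_cancel (Measure.measure_univ_ne_zero.2 (Measure.toSphere_ne_zero _))
    (measure_ne_top _ _)

/-- The function `q` on the sphere is bounded by `Λ` and Lipschitz with constant `Λ`. -/
def IsLipBound (q : C(Sph n, ℝ)) (Λ : ℝ) : Prop :=
  (∀ u, |q u| ≤ Λ) ∧ ∀ u w : Sph n, |q u - q w| ≤ Λ * ‖(u : E n) - w‖

theorem IsLipBound.add {q q' : C(Sph n, ℝ)} {Λ Λ' : ℝ} (h : IsLipBound q Λ)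
    (h' : IsLipBound q' Λ') : IsLipBound (q + q') (Λ + Λ') := by
  refine ⟨fun u => (abs_add_le _ _).trans (add_le_add (h.1 u) (h'.1 u)), fun u w => ?_⟩
  rw [add_mul]
  calc |q u + q' u - (q w + q' w)| = |(q u - q w) + (q' u - q' w)| := by ring_nf
    _ ≤ _ := (abs_add_le _ _).trans (add_le_add (h.2 u w) (h'.2 u w))

theorem IsLipBound.smul {q : C(Sph n, ℝ)} {Λ : ℝ} (h : IsLipBound q Λ) (a : ℝ) :
    IsLipBound (a • q) (|a| * Λ) := by
  refine ⟨fun u => ?_, fun u w => ?_⟩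
  · simpa [abs_mul] using mul_le_mul_of_nonneg_left (h.1 u) (abs_nonneg a)
  · rw [mul_assoc]
    simpa [← mul_sub, abs_mul] using mul_le_mul_of_nonneg_left (h.2 u w) (abs_nonneg a)

theorem IsLipBound.mono {q : C(Sph n, ℝ)} {Λ Λ' : ℝ} (h : IsLipBound q Λ) (hΛ : Λ ≤ Λ') :
    IsLipBound q Λ' :=
  ⟨fun u => (h.1 u).trans hΛ, fun u w => (h.2 u w).trans (by gcongr)⟩

theorem IsLipBound.mul {q q' : C(Sph n, ℝ)} {Λ Λ' : ℝ} (hΛ : 0 ≤ Λ) (hΛ' : 0 ≤ Λ')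
    (h : IsLipBound q Λ) (h' : IsLipBound q' Λ') : IsLipBound (q * q') (2 * (Λ * Λ')) := by
  have hΛΛ := mul_nonneg hΛ hΛ'
  refine ⟨fun u => ?_, fun u w => ?_⟩
  · rw [ContinuousMap.mul_apply, abs_mul]
    nlinarith [mul_le_mul (h.1 u) (h'.1 u) (abs_nonneg _) hΛ]
  · calc |q u * q' u - q w * q' w| = |q u * (q' u - q' w) + (q u - q w) * q' w| := by ring_nf
      _ ≤ |q u| * |q' u - q' w| + |q u - q w| * |q' w| := by
        rw [← abs_mul, ← abs_mul]; exact abs_add_le _ _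
      _ ≤ Λ * (Λ' * ‖(u : E n) - w‖) + Λ * ‖(u : E n) - w‖ * Λ' := by
        gcongr
        exacts [h.1 u, h'.2 u w, h.2 u w, h'.1 w]
      _ = _ := by ring

theorem isLipBound_zero : IsLipBound (0 : C(Sph n, ℝ)) 0 := by simp [IsLipBound]

theorem IsLipBound.sum {ι : Type*} (s : Finset ι) {q : ι → C(Sph n, ℝ)} {Λ : ι → ℝ}
    (h : ∀ i, IsLipBound (q i) (Λ i)) : IsLipBound (∑ i ∈ s, q i) (∑ i ∈ s, Λ i) := by
  classical
  induction s using Finset.induction_on with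
  | empty => simpa using isLipBound_zero
  | insert i s hi ih =>
    rw [Finset.sum_insert hi, Finset.sum_insert hi]
    exact (h i).add ih

theorem exists_isLipBound_polyRestrict (p : MvPolynomial (Fin n) ℝ) :
    ∃ Λ, 0 ≤ Λ ∧ IsLipBound (polyRestrict n p) Λ := by
  induction p using MvPolynomial.induction_on with
  | C a =>
    refine ⟨|a|, abs_nonneg a, fun u => ?_, fun u w => ?_⟩
    · simp
    · simp only [polyRestrict_apply, polyEval_C, sub_self, abs_zero]
      positivity
  | add p q hp hq =>
    obtain ⟨Λ, h0, h⟩ := hp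
    obtain ⟨Λ', h0', h'⟩ := hq
    exact ⟨Λ + Λ', add_nonneg h0 h0', by rw [map_add]; exact h.add h'⟩
  | mul_X p i hp =>
    obtain ⟨Λ, h0, h⟩ := hp
    refine ⟨2 * (Λ * 1), by positivity, ?_⟩
    rw [map_mul]
    refine h.mul h0 zero_le_one ⟨fun u => ?_, fun u w => ?_⟩
    · rw [polyRestrict_apply, polyEval_X]
      simpa using PiLp.norm_apply_le (u : E n) i
    · rw [polyRestrict_apply, polyRestrict_apply, polyEval_X, polyEval_X, one_mul]
      exact PiLp.norm_apply_le ((u : E n) - (w : E n)) i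

/-- On a finite-dimensional space of restrictions of polynomials to the sphere, the `L²` norm
controls the Lipschitz constants of suitable representatives. -/
theorem exists_isLipBound_mul_norm (U : Submodule ℝ (L2 n)) [FiniteDimensional ℝ U]
    (hU : U ≤ ((toL2 n).toLinearMap ∘ₗ (polyRestrict n).toLinearMap).range) :
    ∃ L, 0 ≤ L ∧ ∀ u ∈ U, ∃ q : C(Sph n, ℝ), toL2 n q = u ∧ IsLipBound q (L * ‖u‖) := by
  set b := Module.finBasis ℝ U
  choose p hp using fun i => hU (b i).2
  choose Λ hΛ0 hΛ using fun i => exists_isLipBound_polyRestrict (p i)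
  -- Coordinates on a finite-dimensional space are bounded functionals, so each coefficient is at
  -- most a constant times the `L²` norm.
  set φ := fun i => LinearMap.toContinuousLinearMap (b.coord i)
  refine ⟨∑ i, ‖φ i‖ * Λ i, Finset.sum_nonneg fun i _ => mul_nonneg (norm_nonneg (φ i)) (hΛ0 i),
    fun u hu => ⟨∑ i, b.repr ⟨u, hu⟩ i • polyRestrict n (p i), ?_, ?_⟩⟩
  · have h := congrArg Subtype.val (b.sum_repr ⟨u, hu⟩)
    simp only [Submodule.coe_sum, Submodule.coe_smul] at h
    rw [map_sum]
    conv_rhs => rw [← h]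
    refine Finset.sum_congr rfl fun i _ => ?_
    rw [map_smul]
    exact congrArg _ (hp i)
  · rw [Finset.sum_mul]
    refine IsLipBound.sum _ fun i => ((hΛ i).smul _).mono ?_
    have h : |b.repr ⟨u, hu⟩ i| ≤ ‖φ i‖ * ‖u‖ := (φ i).le_opNorm ⟨u, hu⟩
    calc _ ≤ ‖φ i‖ * ‖u‖ * Λ i := by gcongr; exact hΛ0 i
      _ = _ := by ring

theorem exists_isLipBound_lowPart (n l : ℕ) :
    ∃ L, 0 ≤ L ∧ ∀ f : L2 n, ∃ q : C(Sph n, ℝ), toL2 n q = lowPart n l f ∧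
      IsLipBound q (L * ‖lowPart n l f‖) := by
  set U := (Finset.Icc 1 l).sup (harmonics n)
  obtain ⟨L, hL, h⟩ := exists_isLipBound_mul_norm U (Finset.sup_le fun m _ => by
    rw [harmonics, LinearMap.range_eq_map]
    exact Submodule.map_mono le_top)
  exact ⟨L, hL, fun f => h _ (sum_mem fun m hm =>
    Finset.le_sup (f := harmonics n) hm (Submodule.starProjection_apply_mem _ _))⟩

/-! ### The degree-zero component and the splitting of the expansion -/

theorem component_zero (f : L2 n) :
    ∃ c : ℝ, component n 0 f = toL2 n (ContinuousMap.const _ c) := by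
  obtain ⟨p, hp, h⟩ := mem_harmonics.1 (Submodule.starProjection_apply_mem (harmonics n 0) f)
  have hp' := (mem_harmonicPoly.1 hp).1
  rw [← MvPolynomial.totalDegree_zero_iff_isHomogeneous,
    MvPolynomial.totalDegree_eq_zero_iff_eq_C] at hp'
  refine ⟨p.coeff 0, ?_⟩
  rw [component, ← h, hp']
  congr 1
  ext e
  simp

theorem one_mem_harmonics : toL2 n 1 ∈ harmonics n 0 :=
  mem_harmonics.2 ⟨1, mem_harmonicPoly.2 ⟨MvPolynomial.isHomogeneous_one _ _,
    polyLaplacian_eq_zero two_pos (MvPolynomial.isHomogeneous_one _ _)⟩, by rw [map_one]⟩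

/-- Orthogonality of the remainder to the constant 1 makes the degree-zero component the mean value
of `f`, which inherits the bounds of `f`. -/
theorem exists_component_zero_eq (hn : 0 < n) {f : C(Sph n, ℝ)} {a b : ℝ} (ha : ∀ e, a ≤ f e)
    (hb : ∀ e, f e ≤ b) : ∃ c : ℝ, a ≤ c ∧ c ≤ b ∧
      component n 0 (toL2 n f) = toL2 n (ContinuousMap.const _ c) := by
  have := isProbabilityMeasure_sigma hn
  obtain ⟨c, hc⟩ := component_zero (toL2 n f)
  have h := Submodule.starProjection_inner_eq_zero (K := harmonics n 0) (toL2 n f) _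
    one_mem_harmonics
  change inner ℝ (toL2 n f - component n 0 (toL2 n f)) _ = 0 at h
  have hint : Integrable f (sigma n) :=
    f.continuous.integrable_of_hasCompactSupport (HasCompactSupport.of_compactSpace _)
  rw [hc, ← map_sub, inner_toL2] at h
  simp only [ContinuousMap.sub_apply, ContinuousMap.const_apply, ContinuousMap.one_apply,
    mul_one] at h
  rw [integral_sub hint (integrable_const c), integral_const, probReal_univ, one_smul] at h
  refine ⟨c, ?_, ?_, hc⟩
  · have := integral_mono (integrable_const a) hint ha
    rw [integral_const, probReal_univ, one_smul] at this
    linarith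
  · have := integral_mono hint (integrable_const b) hb
    rw [integral_const, probReal_univ, one_smul] at this
    linarith

theorem component_zero_add_lowPart_add_highPart (hn : 0 < n) (l : ℕ) (f : L2 n) :
    component n 0 f + lowPart n l f + highPart n l f = f := by
  have h := (hasSum_component hn f).summable.sum_add_tsum_nat_add (l + 1)
  rw [(hasSum_component hn f).tsum_eq, Finset.sum_range_eq_add_Ico _ (by omega)] at h
  simp only [highPart, add_comm (l + 1)]
  exact h

/-- The high part is only an `L²` class; this permits replacing it by a continuous representative.
-/
theorem maximal_congr_ae {f g : Sph n → ℝ} (h : f =ᵐ[sigma n] g) (e : Sph n) :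
    maximal f e = maximal g e := by
  simp only [maximal]
  refine iSup_congr fun t => iSup_congr fun _ => ?_
  congr 1
  refine lintegral_congr_ae (ae_restrict_of_ae ?_)
  filter_upwards [h] with x hx
  rw [hx]

/-! ### From separation to the estimate of support minus radial function -/

theorem IsSymmBody.support_sub_radial_le (hn : 0 < n) {K : ConvexBody (E n)} (hK : IsSymmBody K)
    {c Λ δ : ℝ} {q k : C(Sph n, ℝ)} (hδ : δ ≤ 1 / 100) (h1 : ∀ u, |support K u - 1| ≤ δ)
    (hc : 0 ≤ c) (hc2 : c ≤ 2) (hdec : ∀ u, support K u = c + q u + k u) (hq : IsLipBound q Λ)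
    (e : Sph n) :
    ENNReal.ofReal (support K e - radial K e) ≤
      ENNReal.ofReal (24 * Λ * (2 * √δ)) + ENNReal.ofReal (5 * 200 ^ n) * maximal k e := by
  have hδ0 : 0 ≤ δ := (abs_nonneg _).trans (h1 e)
  have hΛ : 0 ≤ Λ := (abs_nonneg _).trans (hq.1 e)
  rcases le_or_gt (support K e) (radial K e) with hle | hlt
  · rw [ENNReal.ofReal_of_nonpos (by linarith)]; exact zero_le
  have key {s : ℝ} (hs : s ∈ Ioo (radial K e) (support K e)) :
      ENNReal.ofReal (support K e - s) ≤
        ENNReal.ofReal (24 * Λ * (2 * √δ)) + ENNReal.ofReal (5 * 200 ^ n) * maximal k e := by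
    obtain ⟨u, hu⟩ := hK.exists_support_lt hs.1
    have hs0 : 0 < s := (radial_nonneg K e).trans_lt hs.1
    set d := ‖(u : E n) - e‖ with hd
    have hd2 : d ^ 2 = 2 * (1 - inner ℝ (e : E n) (u : E n)) := by
      rw [hd, norm_sub_sq_real, real_inner_comm, norm_eq_of_mem_sphere, norm_eq_of_mem_sphere]
      ring
    have he := abs_le.1 (h1 e)
    have hu1 := abs_le.1 (h1 u)
    set i := inner ℝ (e : E n) (u : E n)
    have hi : i ≤ 1 := by nlinarith [sq_nonneg d]
    have hi0 : 0 < i := by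
      by_contra! h
      nlinarith
    -- From `1 - δ ≤ h(u) < s i` and `s < h(e) ≤ 1 + δ`. Hence `1 - i < 2δ`, which gives `d² ≤ 4δ`.
    have h3 : 1 - δ < (1 + δ) * i := by nlinarith [hs.2]
    have h4 : d ^ 2 ≤ (2 * √δ) ^ 2 := by
      rw [mul_pow, Real.sq_sqrt hδ0]
      nlinarith
    have h5 : d ≤ 2 * √δ := (le_abs_self d).trans (abs_le_of_sq_le_sq h4 (by positivity))
    have h6 : d ≤ 1 / 4 := by
      refine (le_abs_self d).trans (abs_le_of_sq_le_sq (h4.trans ?_) (by norm_num))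
      rw [mul_pow, Real.sq_sqrt hδ0]
      linarith
    have hd0 : 0 < d := by
      refine lt_of_le_of_ne (norm_nonneg _) fun h => ?_
      have : u = e := Subtype.ext (sub_eq_zero.1 (norm_eq_zero.1 h.symm))
      rw [this] at hu
      nlinarith [hs.2]
    have hs1 : 1 / 2 ≤ s := by nlinarith
    have h7 := support_sub_le_add_maximal hn K hc hdec hq.1 hq.2 hd0 h6 hd.symm
    have h8 : support K e - s ≤ 24 * Λ * (2 * √δ) +
        (support K e - support K u - c * d ^ 2 / 40 - 24 * Λ * d) := by
      have h9 : 24 * Λ * d ≤ 24 * Λ * (2 * √δ) := by gcongr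
      -- Absorption of the constant part: `c ≤ 2` and `s ≥ 1/2` give `c d²/40 ≤ d²/20 ≤ d²/4 ≤ s
      -- d²/2`.
      have h10 : c * d ^ 2 / 40 ≤ s * (d ^ 2 / 2) := by nlinarith [sq_nonneg d]
      nlinarith
    calc _ ≤ _ := ENNReal.ofReal_le_ofReal h8
      _ ≤ _ := ENNReal.ofReal_add_le
      _ ≤ _ := by gcongr
  have hlim : Filter.Tendsto (fun s => ENNReal.ofReal (support K e - s))
      (nhdsWithin (radial K e) (Ioi (radial K e)))
      (nhds (ENNReal.ofReal (support K e - radial K e))) :=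
    ((ENNReal.continuous_ofReal.comp (by fun_prop : Continuous fun s => support K e - s)).tendsto
      _).mono_left nhdsWithin_le_nhds
  exact le_of_tendsto hlim (Filter.mem_of_superset (Ioo_mem_nhdsGT hlt) fun s hs => key hs)

end SphHarm

end

/-! ### Choice of constants and conclusion -/

theorem lemma2 (n : ℕ) (hn : 2 ≤ n) :
    (∀ K : ConvexBody (SphHarm.E n), SphHarm.IsSymmBody K →
      (∀ e : SphHarm.Sph n, SphHarm.radial K e ≤ SphHarm.support K e) ∧
      HasSum (fun m : ℕ => SphHarm.component n m (SphHarm.toL2 n (SphHarm.support K)))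
        (SphHarm.toL2 n (SphHarm.support K)) ∧
      ∀ m : ℕ, Odd m → SphHarm.component n m (SphHarm.toL2 n (SphHarm.support K)) = 0) ∧
    ∃ C : ℝ, 0 < C ∧ ∀ ε : ℝ, 0 < ε → ∀ l : ℕ, ∃ δ₀ : ℝ, 0 < δ₀ ∧
      ∀ K : ConvexBody (SphHarm.E n), SphHarm.IsSymmBody K →
        ‖SphHarm.support K - 1‖ ≤ δ₀ →
        ∀ e : SphHarm.Sph n,
          ENNReal.ofReal (SphHarm.support K e - SphHarm.radial K e) ≤
            ENNReal.ofReal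
              (ε * ‖SphHarm.lowPart n l (SphHarm.toL2 n (SphHarm.support K))‖) +
            ENNReal.ofReal C *
              SphHarm.maximal
                (SphHarm.highPart n l (SphHarm.toL2 n (SphHarm.support K))) e := by
  have hn0 : 0 < n := by omega
  refine ⟨fun K hK => ⟨hK.radial_le_support, SphHarm.hasSum_component hn0 _,
    fun m hm => SphHarm.component_eq_zero_of_even hn0 hm hK.support_neg⟩,
    5 * 200 ^ n, by positivity, fun ε hε l => ?_⟩
  obtain ⟨L, hL, hlow⟩ := SphHarm.exists_isLipBound_lowPart n l
  -- The low part costs `24 Λ · 2√δ` with `Λ = L‖η‖`, so `√δ ≤ a` with `48 L a ≤ ε` suffices; the `+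
  -- 1` keeps the denominator positive when `L = 0`. The cap `1/100` on `δ` below ensures `d ≤ 1/4`.
  set a := ε / (48 * L + 1) with ha
  have ha0 : 0 < a := by positivity
  have haL : 48 * L * a ≤ ε := by
    rw [ha, mul_div_assoc', div_le_iff₀ (by positivity)]
    nlinarith
  refine ⟨min (1 / 100) (a ^ 2), by positivity, fun K hK hδ e => ?_⟩
  have h1 (u : SphHarm.Sph n) : |SphHarm.support K u - 1| ≤ min (1 / 100) (a ^ 2) :=
    ((SphHarm.support K - 1).norm_coe_le_norm u).trans hδ
  obtain ⟨q, hq, hqL⟩ := hlow (SphHarm.toL2 n (SphHarm.support K))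
  obtain ⟨c, hc0, hc2, hc⟩ := SphHarm.exists_component_zero_eq hn0 (f := SphHarm.support K)
    (a := 0) (b := 2)
    (fun u => by
      have := (abs_le.1 (h1 u)).1
      have := min_le_left (1 / 100) (a ^ 2)
      linarith)
    (fun u => by
      have := (abs_le.1 (h1 u)).2
      have := min_le_left (1 / 100) (a ^ 2)
      linarith)
  set k : C(SphHarm.Sph n, ℝ) := SphHarm.support K - ContinuousMap.const _ c - q
  have hk : SphHarm.toL2 n k = SphHarm.highPart n l (SphHarm.toL2 n (SphHarm.support K)) := by
    have := SphHarm.component_zero_add_lowPart_add_highPart hn0 l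
      (SphHarm.toL2 n (SphHarm.support K))
    rw [map_sub, map_sub, hq, ← hc]
    nth_rewrite 1 [← this]
    abel
  have hkm : SphHarm.maximal k e =
      SphHarm.maximal (SphHarm.highPart n l (SphHarm.toL2 n (SphHarm.support K))) e := by
    rw [← hk]
    exact (SphHarm.maximal_congr_ae (ContinuousMap.coeFn_toLp (𝕜 := ℝ) (SphHarm.sigma n) k) e).symm
  have hmain := hK.support_sub_radial_le hn0 (min_le_left _ _) h1 hc0 hc2 (q := q) (k := k)
    (fun u => by simp [k]) hqL e
  rw [hkm] at hmain
  refine hmain.trans (add_le_add_left (ENNReal.ofReal_le_ofReal ?_) _)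
  have hsqrt : √(min (1 / 100) (a ^ 2)) ≤ a :=
    (Real.sqrt_le_sqrt (min_le_right _ _)).trans (Real.sqrt_sq ha0.le).le
  have hη := norm_nonneg (SphHarm.lowPart n l (SphHarm.toL2 n (SphHarm.support K)))
  set η := ‖SphHarm.lowPart n l (SphHarm.toL2 n (SphHarm.support K))‖
  calc 24 * (L * η) * (2 * √(min (1 / 100) (a ^ 2))) ≤ 24 * (L * η) * (2 * a) := by gcongr
    _ = 48 * L * a * η := by ring
    _ ≤ ε * η := by gcongr
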